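/- Let $n \ge 3$, let $\mathfrak{S}_n$ be the symmetric group (the Coxeter group of type $A_{n-1}$), with permutations composed from right to left, and let $T$ be its set of transpositions. For $w \in \mathfrak{S}_n$ let $\ell_T(w)$ be the least number of elements of $T$ whose product is $w$, and write $u \le_T v$ if $\ell_T(v) = \ell_T(u) + \ell_T(u^{-1}v)$. Let $c$ be a Coxeter element of $\mathfrak{S}_n$, that is, an $n$-cycle, for example $c = (1\ 2\ \cdots\ n)$, and let $NC(\mathfrak{S}_n,c) = \{w \in \mathfrak{S}_n : e \le_T w \le_T c\}$, which is a lattice under $\le_T$. Put $$\pi_T(w) = \bigvee_{t \in T,\ t \le_T w} t \quad \text{(join in } NC(\mathfrak{S}_n,c)), \qquad \mathrm{Pop}_T(w) = w \cdot \pi_T(w)^{-1}.$$ Say that $w$ requires exactly $k$ iterations of $\mathrm{Pop}_T$ to reach the identity if $k$ is the least integer $m \ge 0$ with $\mathrm{Pop}_T^m(w) = e$. Then the number of permutations $w \in \mathfrak{S}_n$ that require exactly $n-2$ or exactly $n-1$ iterations of $\mathrm{Pop}_T$ to reach the identity is $$2^n - \binom{n}{2}.$$ -/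

import Mathlib

namespace PopTsack

/-- The set `T` of reflections of the symmetric group: the transpositions. -/
def reflections (n : ℕ) : Set (Equiv.Perm (Fin n)) :=
  {t | t.IsSwap}

/-- The absolute length `ℓ_T(w)`: the least length of a word in the reflections with product `w`.
The transpositions generate the symmetric group, so the set below is never empty. -/
noncomputable def absLength {n : ℕ} (w : Equiv.Perm (Fin n)) : ℕ :=
  sInf {k | ∃ l : List (Equiv.Perm (Fin n)),
    l.length = k ∧ (∀ t ∈ l, t ∈ reflections n) ∧ l.prod = w}

/-- The absolute order `u ≤_T v`. -/
def AbsLE {n : ℕ} (u v : Equiv.Perm (Fin n)) : Prop :=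
  absLength v = absLength u + absLength (u⁻¹ * v)

/-- The noncrossing partitions `NC(𝔖_n, c) = [e, c]`, an interval of the absolute order. -/
def NC {n : ℕ} (c : Equiv.Perm (Fin n)) : Set (Equiv.Perm (Fin n)) :=
  {w | AbsLE 1 w ∧ AbsLE w c}

/-- `v` lies in `NC(𝔖_n, c)` and is above every reflection `t ≤_T w`. -/
def IsNCUpperBound {n : ℕ} (c w v : Equiv.Perm (Fin n)) : Prop :=
  v ∈ NC c ∧ ∀ t ∈ reflections n, AbsLE t w → AbsLE t v

/-- `v` is the join, in `NC(𝔖_n, c)`, of all reflections `t ≤_T w`. -/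
def IsNCJoin {n : ℕ} (c w v : Equiv.Perm (Fin n)) : Prop :=
  IsNCUpperBound c w v ∧ ∀ u, IsNCUpperBound c w u → AbsLE v u

open Classical in
/-- The noncrossing projection `π_T(w, c)`, the join in `NC(𝔖_n, c)` of all reflections
`t ≤_T w`. For a Coxeter element `c` the join always exists and is unique, because `NC(𝔖_n, c)`
is a lattice containing all reflections; the default value is then never used. -/
noncomputable def ncProj {n : ℕ} (c w : Equiv.Perm (Fin n)) : Equiv.Perm (Fin n) :=
  if h : ∃ v, IsNCJoin c w v then h.choose else 1

/-- The Coxeter pop-tsack torsing operator `Pop_T(w, c) = w · π_T(w, c)⁻¹`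
(permutations are composed from right to left). -/
noncomputable def popT {n : ℕ} (c w : Equiv.Perm (Fin n)) : Equiv.Perm (Fin n) :=
  w * (ncProj c w)⁻¹

/-- `w` requires exactly `k` iterations of `Pop_T` to reach the identity. -/
def RequiresExactly {n : ℕ} (c w : Equiv.Perm (Fin n)) (k : ℕ) : Prop :=
  IsLeast {m : ℕ | (popT c)^[m] w = 1} k

end PopTsack

/- Let `n = m + 1`, fix `c = (0 1 ⋯ m)` and read `u = w⁻¹` as a configuration in which token `j`
sits at position `u j`. The join of the transpositions below `w` is the block rotation of the
noncrossing closure of the cycle partition of `w`, so one step of `popT` moves every token to the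
cyclically next position of its block in that closure (`torse`). The last token `m` moves strictly
upwards until it is home, and conjugation by powers of `c` turns any token into the last one; hence
`m` steps always suffice.

If `m - 2` steps do not suffice, then some token, the last one after a rotation, skips at most one
position on its way. This forces `z = c⁻¹u` to have at most one descent, so that `z` is the
increasing cycle on its support `S`, and `S` is not a pair of elements that are not cyclically
adjacent. Conversely every such `z` is slow. What remains is to count the sets `S` that are neither
singletons nor nonadjacent pairs: `2 ^ n - n - (n.choose 2 - n)`. -/

namespace PopTsack

open Equiv Equiv.Perm

section FixedFunctions

variable {α : Type*}

/-- The functions on `α` that are constant along `w`. By Carter's lemma the absolute length of `w`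
is the codimension of this subspace. -/
def fixedFunctions (w : Perm α) : Submodule ℚ (α → ℚ) where
  carrier := {f | ∀ a, f (w a) = f a}
  add_mem' hf hg a := congrArg₂ (· + ·) (hf a) (hg a)
  zero_mem' _ := rfl
  smul_mem' r _ hf a := congrArg (r • ·) (hf a)

lemma fixedFunctions_one : fixedFunctions (1 : Perm α) = ⊤ :=
  eq_top_iff.2 fun _ _ _ => rfl

lemma inf_fixedFunctions_le_mul (u v : Perm α) :
    fixedFunctions u ⊓ fixedFunctions v ≤ fixedFunctions (u * v) := fun _ ⟨hu, hv⟩ a =>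
  (hu (v a)).trans (hv a)

lemma apply_eq_of_sameCycle {β : Type*} {w : Perm α} {f : α → β} (hf : ∀ a, f (w a) = f a)
    {a b : α} (h : w.SameCycle a b) : f a = f b := by
  obtain ⟨k, rfl⟩ := h
  induction k with
  | zero => rfl
  | succ k ih => rw [add_comm, zpow_add, zpow_one, Perm.mul_apply, hf, ← ih]
  | pred k ih => rw [← hf ((w ^ (-(k : ℤ) - 1)) a), ← Perm.mul_apply, ← zpow_one_add,
      add_sub_cancel, ← ih]

variable [DecidableEq α]

lemma mem_fixedFunctions_swap {a b : α} {f : α → ℚ} :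
    f ∈ fixedFunctions (swap a b) ↔ f a = f b := by
  refine ⟨fun h => by simpa using h b, fun h c => ?_⟩
  rw [swap_apply_def]
  grind

lemma sameCycle_iff_fixedFunctions_le {w : Perm α} {a b : α} :
    w.SameCycle a b ↔ fixedFunctions w ≤ fixedFunctions (swap a b) := by
  classical
  refine ⟨fun h f hf => mem_fixedFunctions_swap.2 (apply_eq_of_sameCycle hf h), fun h => ?_⟩
  have hf : (fun c => if w.SameCycle a c then (1 : ℚ) else 0) ∈ fixedFunctions w := fun c => by
    simp only [sameCycle_apply_right]
  have := mem_fixedFunctions_swap.1 (h hf)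
  by_contra hab
  simp [hab, SameCycle.refl] at this

lemma finrank_le_finrank_inf_swap_add_one [Finite α] (V : Submodule ℚ (α → ℚ)) (a b : α) :
    Module.finrank ℚ V
      ≤ Module.finrank ℚ (V ⊓ fixedFunctions (swap a b) : Submodule ℚ (α → ℚ)) + 1 := by
  let φ : V →ₗ[ℚ] ℚ := ((LinearMap.proj a : (α → ℚ) →ₗ[ℚ] ℚ) - LinearMap.proj b).domRestrict V
  have hker : (LinearMap.ker φ).map V.subtype = V ⊓ fixedFunctions (swap a b) := by
    ext f
    simp [φ, mem_fixedFunctions_swap, sub_eq_zero, and_comm]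
  have hrange : Module.finrank ℚ (LinearMap.range φ) ≤ 1 := by
    simpa using (LinearMap.range φ).finrank_le
  rw [← hker, Submodule.finrank_map_subtype_eq, ← φ.finrank_range_add_finrank_ker]
  omega

lemma card_le_length_add_finrank [Fintype α] {l : List (Perm α)} (hl : ∀ t ∈ l, t.IsSwap) :
    Fintype.card α ≤ l.length + Module.finrank ℚ (fixedFunctions l.prod) := by
  induction l with
  | nil =>
    rw [List.prod_nil, fixedFunctions_one, finrank_top, Module.finrank_fintype_fun_eq_card]
    exact Nat.le_add_left _ _
  | cons t l ih =>
    obtain ⟨⟨a, b, -, rfl⟩, htl⟩ := List.forall_mem_cons.1 hl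
    have hinf := Submodule.finrank_mono (inf_fixedFunctions_le_mul (swap a b) l.prod)
    have hdrop := finrank_le_finrank_inf_swap_add_one (fixedFunctions l.prod) a b
    rw [inf_comm] at hdrop
    rw [List.prod_cons, List.length_cons]
    linarith [ih htl]

lemma fixedFunctions_lt_swap_mul {w : Perm α} {a : α} (ha : w a ≠ a) :
    fixedFunctions w < fixedFunctions (swap a (w a) * w) := by
  refine lt_of_le_of_ne (fun f hf => inf_fixedFunctions_le_mul _ _
    ⟨mem_fixedFunctions_swap.2 (hf a).symm, hf⟩) fun h => ?_
  have hfix : (swap a (w a) * w) a = a := by simp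
  have hmem : (Pi.single a 1 : α → ℚ) ∈ fixedFunctions (swap a (w a) * w) := fun c => by
    rcases eq_or_ne c a with rfl | hc
    · rw [hfix]
    · rw [Pi.single_eq_of_ne hc,
        Pi.single_eq_of_ne fun h => hc (Equiv.injective _ (h.trans hfix.symm))]
  rw [← h] at hmem
  simpa [ha] using hmem a

end FixedFunctions

section AbsLength

variable {n : ℕ}

lemma exists_word_length_eq (w : Perm (Fin n)) :
    ∃ l : List (Perm (Fin n)),
      l.length = absLength w ∧ (∀ t ∈ l, t ∈ reflections n) ∧ l.prod = w := by
  obtain ⟨l, hl, hs⟩ := (truncSwapFactors w).out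
  exact Nat.sInf_mem (s := {k | ∃ l : List (Perm (Fin n)),
    l.length = k ∧ (∀ t ∈ l, t ∈ reflections n) ∧ l.prod = w}) ⟨l.length, l, rfl, hs, hl⟩

lemma absLength_prod_le {l : List (Perm (Fin n))} (hl : ∀ t ∈ l, t ∈ reflections n) :
    absLength l.prod ≤ l.length :=
  Nat.sInf_le ⟨l, rfl, hl, rfl⟩

lemma absLength_eq_zero_iff {w : Perm (Fin n)} : absLength w = 0 ↔ w = 1 := by
  constructor
  · intro h
    obtain ⟨l, hl, -, rfl⟩ := exists_word_length_eq w
    rw [h, List.length_eq_zero_iff] at hl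
    rw [hl, List.prod_nil]
  · rintro rfl
    exact Nat.le_zero.1 (absLength_prod_le (l := []) (by simp))

lemma absLength_one : absLength (1 : Perm (Fin n)) = 0 := absLength_eq_zero_iff.2 rfl

lemma absLength_mul_le (u v : Perm (Fin n)) :
    absLength (u * v) ≤ absLength u + absLength v := by
  obtain ⟨l, hl, hs, rfl⟩ := exists_word_length_eq u
  obtain ⟨l', hl', hs', rfl⟩ := exists_word_length_eq v
  rw [← hl, ← hl', ← List.length_append, ← List.prod_append]
  exact absLength_prod_le fun t ht => (List.mem_append.1 ht).elim (hs t) (hs' t)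

lemma absLength_swap {i j : Fin n} (h : i ≠ j) : absLength (swap i j) = 1 := by
  have hle : absLength (swap i j) ≤ 1 := by
    simpa using absLength_prod_le (l := [swap i j]) (by simpa using ⟨i, j, h, rfl⟩)
  have hne : absLength (swap i j) ≠ 0 := by simpa [absLength_eq_zero_iff, swap_eq_one_iff] using h
  omega

lemma absLength_conj (g w : Perm (Fin n)) : absLength (g * w * g⁻¹) = absLength w := by
  have hle : ∀ g w : Perm (Fin n), absLength (g * w * g⁻¹) ≤ absLength w := fun g w => by
    obtain ⟨l, hl, hs, rfl⟩ := exists_word_length_eq w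
    rw [← hl, ← List.length_map (MulAut.conj g), ← MulAut.conj_apply, map_list_prod]
    refine absLength_prod_le fun t ht => ?_
    obtain ⟨s, hs', rfl⟩ := List.mem_map.1 ht
    obtain ⟨i, j, hij, rfl⟩ := hs s hs'
    exact ⟨g i, g j, g.injective.ne hij, (swap_apply_apply g i j).symm⟩
  refine le_antisymm (hle g w) ?_
  simpa [mul_assoc] using hle g⁻¹ (g * w * g⁻¹)

lemma absLength_add_finrank_fixedFunctions_le (w : Perm (Fin n)) :
    absLength w + Module.finrank ℚ (fixedFunctions w) ≤ n := by
  induction hk : n - Module.finrank ℚ (fixedFunctions w) using Nat.strong_induction_on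
    generalizing w with
  | _ k ih =>
    have hbound : ∀ v : Perm (Fin n), Module.finrank ℚ (fixedFunctions v) ≤ n := fun v => by
      simpa using (fixedFunctions v).finrank_le
    by_cases hw : w = 1
    · rw [hw, absLength_one, zero_add]
      exact hbound 1
    obtain ⟨i, hi⟩ : ∃ i, w i ≠ i := by
      by_contra! h
      exact hw (Equiv.ext h)
    have hlt := Submodule.finrank_lt_finrank_of_lt (fixedFunctions_lt_swap_mul hi)
    have hlt_n := hbound (swap i (w i) * w)
    have hrec := ih _ (by omega) (swap i (w i) * w) rfl
    have hmul := absLength_mul_le (swap i (w i)) (swap i (w i) * w)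
    rw [swap_mul_self_mul, absLength_swap hi.symm] at hmul
    omega

lemma absLength_add_finrank_fixedFunctions (w : Perm (Fin n)) :
    absLength w + Module.finrank ℚ (fixedFunctions w) = n := by
  refine le_antisymm (absLength_add_finrank_fixedFunctions_le w) ?_
  obtain ⟨l, hl, hs, rfl⟩ := exists_word_length_eq w
  simpa [hl] using card_le_length_add_finrank hs

lemma absLength_swap_mul_ne {i j : Fin n} (h : i ≠ j) (w : Perm (Fin n)) :
    absLength (swap i j * w) ≠ absLength w := by
  have hsign : ∀ v : Perm (Fin n), sign v = (-1) ^ absLength v := fun v => by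
    obtain ⟨l, hl, hs, rfl⟩ := exists_word_length_eq v
    rw [← hl, sign_prod_list_swap hs]
  intro he
  have hneg := hsign (swap i j * w)
  rw [he, ← hsign, Perm.sign_mul, sign_swap h, neg_one_mul] at hneg
  rcases Int.units_eq_one_or (sign w) with hw | hw <;> rw [hw] at hneg <;>
    exact absurd hneg (by decide)

lemma absLength_swap_mul_add_one_eq_iff {w : Perm (Fin n)} {i j : Fin n} (hij : i ≠ j) :
    absLength (swap i j * w) + 1 = absLength w ↔ w.SameCycle i j := by
  have hw := absLength_add_finrank_fixedFunctions w
  have hsw := absLength_add_finrank_fixedFunctions (swap i j * w)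
  rw [sameCycle_iff_fixedFunctions_le]
  constructor
  · intro h
    have hle := inf_fixedFunctions_le_mul (swap i j) (swap i j * w)
    rw [swap_mul_self_mul] at hle
    have hdrop := finrank_le_finrank_inf_swap_add_one (fixedFunctions (swap i j * w)) i j
    rw [inf_comm] at hdrop
    rw [← Submodule.eq_of_le_of_finrank_le hle (by omega)]
    exact inf_le_left
  · intro h
    have hmono := Submodule.finrank_mono
      ((le_inf h le_rfl).trans (inf_fixedFunctions_le_mul (swap i j) w))
    have hmul := absLength_mul_le (swap i j) (swap i j * w)
    rw [swap_mul_self_mul, absLength_swap hij] at hmul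
    have hne := absLength_swap_mul_ne hij w
    omega

lemma absLength_mul_swap_add_one_eq_iff {w : Perm (Fin n)} {i j : Fin n} (hij : i ≠ j) :
    absLength (w * swap i j) + 1 = absLength w ↔ w.SameCycle i j := by
  rw [mul_swap_eq_swap_mul, absLength_swap_mul_add_one_eq_iff (w.injective.ne hij),
    sameCycle_apply_left, sameCycle_apply_right]

lemma absLE_one (w : Perm (Fin n)) : AbsLE 1 w := by simp [AbsLE, absLength_one]

lemma absLE_refl (w : Perm (Fin n)) : AbsLE w w := by simp [AbsLE, absLength_one]

lemma AbsLE.antisymm {u v : Perm (Fin n)} (huv : AbsLE u v) (hvu : AbsLE v u) : u = v := by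
  unfold AbsLE at huv hvu
  have hzero : absLength (u⁻¹ * v) = 0 := by omega
  exact inv_mul_eq_one.1 (absLength_eq_zero_iff.1 hzero)

lemma AbsLE.trans {u v w : Perm (Fin n)} (huv : AbsLE u v) (hvw : AbsLE v w) : AbsLE u w := by
  unfold AbsLE at *
  have h₁ := absLength_mul_le u (u⁻¹ * w)
  have h₂ := absLength_mul_le (u⁻¹ * v) (v⁻¹ * w)
  rw [mul_inv_cancel_left] at h₁
  rw [mul_assoc, mul_inv_cancel_left] at h₂
  omega

lemma absLE_conj_iff (g : Perm (Fin n)) {u v : Perm (Fin n)} :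
    AbsLE (g * u * g⁻¹) (g * v * g⁻¹) ↔ AbsLE u v := by
  have : (g * u * g⁻¹)⁻¹ * (g * v * g⁻¹) = g * (u⁻¹ * v) * g⁻¹ := by group
  rw [AbsLE, this, absLength_conj, absLength_conj, absLength_conj, AbsLE]

lemma absLE_swap_iff {w : Perm (Fin n)} {i j : Fin n} (hij : i ≠ j) :
    AbsLE (swap i j) w ↔ w.SameCycle i j := by
  rw [AbsLE, absLength_swap hij, swap_inv, ← absLength_swap_mul_add_one_eq_iff hij, eq_comm,
    add_comm]

lemma absLE_mul_swap {w : Perm (Fin n)} {i j : Fin n} (hij : i ≠ j) (h : w.SameCycle i j) :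
    AbsLE (w * swap i j) w := by
  rw [AbsLE, mul_inv_rev, inv_mul_cancel_right, swap_inv, absLength_swap hij,
    (absLength_mul_swap_add_one_eq_iff hij).2 h]

lemma AbsLE.exists_mul_swap {v g : Perm (Fin n)} (h : AbsLE v g) (hne : v ≠ g) :
    ∃ i j, (v * swap i j).SameCycle i j ∧ AbsLE (v * swap i j) g ∧
      absLength ((v * swap i j)⁻¹ * g) < absLength (v⁻¹ * g) := by
  obtain ⟨l, hl, hs, hp⟩ := exists_word_length_eq (v⁻¹ * g)
  cases l with
  | nil => exact absurd (inv_mul_eq_one.1 hp.symm) hne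
  | cons t l =>
    obtain ⟨⟨i, j, hij, rfl⟩, htl⟩ := List.forall_mem_cons.1 hs
    have hp' : l.prod = (v * swap i j)⁻¹ * g := by
      rw [mul_inv_rev, swap_inv, mul_assoc, ← hp, List.prod_cons, swap_mul_self_mul]
    have hlen := absLength_prod_le htl
    have hmul := absLength_mul_le (v * swap i j) ((v * swap i j)⁻¹ * g)
    have hswap := absLength_mul_le v (swap i j)
    rw [hp'] at hlen
    rw [mul_inv_cancel_left] at hmul
    rw [absLength_swap hij] at hswap
    rw [List.length_cons] at hl
    unfold AbsLE at *
    refine ⟨i, j, (absLength_mul_swap_add_one_eq_iff hij).1 ?_, ?_, ?_⟩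
    · rw [mul_swap_mul_self]
      omega
    all_goals omega

end AbsLength

section CyclicArcs

variable {α : Type*} [LinearOrder α] {a b x y : α}

/-- The half-open cyclic arc `(a, b]`, traversed upwards from `a` and wrapping around; it is
everything when `a = b`. -/
def cIoc (a b : α) : Set α := if a < b then Set.Ioc a b else (Set.Ioc b a)ᶜ

lemma mem_cIoc : x ∈ cIoc a b ↔ if a < b then a < x ∧ x ≤ b else b < x → a < x := by
  unfold cIoc
  split_ifs <;> simp

lemma mem_cIoc_of_lt (hab : a < b) : x ∈ cIoc a b ↔ a < x ∧ x ≤ b := by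
  rw [mem_cIoc, if_pos hab]

lemma notMem_cIoc_swap (hab : a ≠ b) (hx : x ∈ cIoc a b) : x ∉ cIoc b a := by grind [mem_cIoc]

lemma eq_of_mem_cIoc (hx : x ∈ cIoc a y) (hy : y ∈ cIoc a x) : x = y := by grind [mem_cIoc]

/-- No two blocks of the partition `R` cross. -/
def IsNonCrossing (R : Setoid α) : Prop :=
  ∀ a b c d, a < b → b < c → c < d → R a c → R b d → R a b

lemma IsNonCrossing.rel {R : Setoid α} (hR : IsNonCrossing R) (hab : R a b) (hxy : R x y)
    (hx : x ∈ cIoc a b) (hy : y ∉ cIoc a b) : R a x := by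
  by_contra hax
  have hxa : x ≠ a := fun h => hax (h ▸ R.refl x)
  have hxb : x ≠ b := fun h => hax (h ▸ hab)
  have hay : ¬ R a y := fun h => hax (R.trans h (R.symm hxy))
  have hya : y ≠ a := fun h => hay (h ▸ R.refl y)
  rw [mem_cIoc] at hx hy
  split_ifs at hx hy with hlt
  · rcases lt_or_gt_of_ne hya with hya | hya
    · exact hay (R.symm (hR y a x b hya hx.1 (hx.2.lt_of_ne hxb) (R.symm hxy) hab))
    · exact hax (hR a x b y hx.1 (hx.2.lt_of_ne hxb) (by grind) hab hxy)
  · obtain ⟨hby, hya⟩ : b < y ∧ y < a := by grind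
    rcases lt_or_gt_of_ne hxb with hxb | hxb
    · exact hax (R.trans hab (R.symm (hR x b y a hxb hby hya hxy (R.symm hab))))
    · exact hay (R.trans hab (hR b y a x hby hya (hx hxb) (R.symm hab) (R.symm hxy)))

lemma IsNonCrossing.mem_Icc_of_rel {R : Setoid α} (hR : IsNonCrossing R) (hab : R b a)
    (h : ∀ x, R b x → x ∈ Set.Icc a b) (hx : x ∈ Set.Icc a b) (hxy : R x y) : y ∈ Set.Icc a b := by
  by_cases hbx : R b x
  · exact h y (R.trans hbx hxy)
  have hax : a < x := hx.1.lt_of_ne fun h => hbx (h ▸ hab)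
  have hxb : x < b := hx.2.lt_of_ne fun h => hbx (h ▸ R.refl b)
  refine ⟨?_, ?_⟩ <;> by_contra! hlt
  · exact hbx (R.trans (R.trans hab (R.symm (hR y a x b hlt hax hxb (R.symm hxy) (R.symm hab))))
      (R.symm hxy))
  · exact hbx (R.trans hab (hR a x b y hax hxb hlt (R.symm hab) hxy))

lemma isNonCrossing_ker_mem {s : Set α} (hs : s.OrdConnected) :
    IsNonCrossing (Setoid.ker (· ∈ s)) := by
  intro a b c d hab hbc hcd hac hbd
  simp only [Setoid.ker_def, eq_iff_iff] at *
  exact ⟨fun ha => hs.out ha (hac.1 ha) ⟨hab.le, hbc.le⟩,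
    fun hb => hac.2 (hs.out hb (hbd.1 hb) ⟨hbc.le, hcd.le⟩)⟩

/-- The permutation `v` sends every element to the cyclically next element of its `R`-block. -/
structure IsBlockRotation (R : Setoid α) (v : Perm α) : Prop where
  rel : ∀ a, R a (v a)
  apply_mem_cIoc : ∀ {a b}, R a b → v a ∈ cIoc a b

namespace IsBlockRotation

variable {R : Setoid α} {v p q : Perm α}

lemma unique (hp : IsBlockRotation R p) (hq : IsBlockRotation R q) : p = q :=
  Equiv.ext fun a => eq_of_mem_cIoc (hp.apply_mem_cIoc (hq.rel a)) (hq.apply_mem_cIoc (hp.rel a))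

lemma sameCycle_iff [Finite α] (h : IsBlockRotation R v) : v.SameCycle a b ↔ R a b := by
  refine ⟨fun hab => Quotient.exact (apply_eq_of_sameCycle
    (fun a => Quotient.sound (R.symm (h.rel a))) hab), fun hab => ?_⟩
  have hlt : ∀ a b, a < b → R a b → v.SameCycle a b := fun a b => by
    induction a using WellFoundedGT.induction with
    | ind a ih =>
      intro hlt hab
      obtain ⟨hav, hvb⟩ := (mem_cIoc_of_lt hlt).1 (h.apply_mem_cIoc hab)
      rw [← sameCycle_apply_left]
      rcases hvb.eq_or_lt with hvb | hvb
      · rw [hvb]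
      · exact ih (v a) hav hvb (R.trans (R.symm (h.rel a)) hab)
  rcases lt_trichotomy a b with h | rfl | h
  · exact hlt a b h hab
  · exact .refl v a
  · exact (hlt b a h (R.symm hab)).symm

lemma mem_gap (hR : IsNonCrossing R) (h : IsBlockRotation R v) (hx : x ∈ cIoc a (v a))
    (hne : x ≠ v a) (hxy : R x y) : y ∈ cIoc a (v a) ∧ y ≠ v a := by
  have hax : ¬ R a x := fun hax => hne (eq_of_mem_cIoc hx (h.apply_mem_cIoc hax))
  exact ⟨by_contra fun hy => hax (hR.rel (h.rel a) hxy hx hy),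
    fun hy => hax (R.trans (h.rel a) (R.symm (hy ▸ hxy)))⟩

lemma conj {g : Perm α} (hg : ∀ a b x, g x ∈ cIoc (g a) (g b) ↔ x ∈ cIoc a b)
    (h : IsBlockRotation R v) : IsBlockRotation (R.comap g.symm) (g * v * g⁻¹) where
  rel a := by simpa [Setoid.comap_rel] using h.rel (g.symm a)
  apply_mem_cIoc {a b} hab := by
    simpa using (hg (g.symm a) (g.symm b) (v (g.symm a))).2 (h.apply_mem_cIoc hab)

end IsBlockRotation

variable [Finite α]

lemma exists_isBlockRotation (R : Setoid α) : ∃ v, IsBlockRotation R v := by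
  have hnext : ∀ a, ∃ y, R a y ∧ ∀ b, R a b → y ∈ cIoc a b := fun a => by
    by_cases h : ∃ b, R a b ∧ a < b
    · obtain ⟨y, hy, hmin⟩ := Set.exists_min_image {b | R a b ∧ a < b} id (Set.toFinite _) h
      refine ⟨y, hy.1, fun b hb => ?_⟩
      have hay : a < y := hy.2
      have hyb : a < b → y ≤ b := fun hab => hmin b ⟨hb, hab⟩
      grind [mem_cIoc]
    · obtain ⟨y, hy, hmin⟩ := Set.exists_min_image {b | R a b} id (Set.toFinite _) ⟨a, R.refl a⟩
      refine ⟨y, hy, fun b hb => ?_⟩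
      have hyb : y ≤ b := hmin b hb
      have hba : ¬ a < b := fun hab => h ⟨b, hb, hab⟩
      grind [mem_cIoc]
  choose f hrel hmem using hnext
  have hinj : Function.Injective f := fun a a' he => by
    by_contra hne
    have haa' : R a a' := R.trans (hrel a) (he ▸ R.symm (hrel a'))
    exact notMem_cIoc_swap hne (hmem a a' haa') (he ▸ hmem a' a (R.symm haa'))
  exact ⟨Equiv.ofBijective f (Finite.injective_iff_bijective.1 hinj), hrel, hmem _ _⟩

/-- The permutation sending every element to the cyclically next element of its block. -/
noncomputable def blockRotation (R : Setoid α) : Perm α := (exists_isBlockRotation R).choose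

lemma isBlockRotation_blockRotation (R : Setoid α) : IsBlockRotation R (blockRotation R) :=
  (exists_isBlockRotation R).choose_spec

lemma IsBlockRotation.eq_blockRotation {R : Setoid α} {v : Perm α} (h : IsBlockRotation R v) :
    v = blockRotation R :=
  h.unique (isBlockRotation_blockRotation R)

end CyclicArcs

section SplitBlock

variable {α : Type*} [LinearOrder α] {P Q R : Setoid α} {i j a b : α} {p q v : Perm α}

/-- The partition that cuts the block of `i` into its part in the arc `(i, j]` and the rest. -/
def splitBlock (R : Setoid α) (i j : α) : Setoid α := R ⊓ Setoid.ker fun a => R i a ∧ a ∈ cIoc i j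

lemma splitBlock_rel :
    splitBlock R i j a b ↔ R a b ∧ ((R i a ∧ a ∈ cIoc i j) ↔ (R i b ∧ b ∈ cIoc i j)) := by
  rw [splitBlock, Setoid.inf_def]
  simp only [Pi.inf_apply, inf_Prop_eq, Setoid.ker_def, eq_iff_iff]

lemma IsNonCrossing.splitBlock (hR : IsNonCrossing R) : IsNonCrossing (splitBlock R i j) := by
  intro a b c d hab hbc hcd hac hbd
  rw [splitBlock_rel] at *
  have hRab := hR a b c d hab hbc hcd hac.1 hbd.1
  refine ⟨hRab, ?_⟩
  by_cases ha : R i a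
  · have hib := R.trans ha hRab
    have hic := R.trans ha hac.1
    have hid := R.trans hib hbd.1
    simp only [ha, hib, hic, hid, true_and] at *
    grind [mem_cIoc]
  · have hib : ¬ R i b := fun hb => ha (R.trans hb (R.symm hRab))
    simp only [ha, hib, false_and]

lemma IsBlockRotation.mul_swap (h : IsBlockRotation R v) (hij : R i j) :
    IsBlockRotation (splitBlock R i j) (v * swap i j) := by
  have hout : ∀ a, ¬ R i a → swap i j a = a := fun a ha =>
    swap_apply_of_ne_of_ne (fun h => ha (h ▸ R.refl i)) fun h => ha (h ▸ hij)
  have hrel : ∀ a, R a (v (swap i j a)) := fun a => by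
    rw [swap_apply_def]
    split_ifs with hai haj
    · exact hai ▸ R.trans hij (h.rel j)
    · exact haj ▸ R.trans (R.symm hij) (h.rel i)
    · exact h.rel a
  have hmem : ∀ a, R i a → (a ∈ cIoc i j ↔ v (swap i j a) ∈ cIoc i j) := fun a ha => by
    have hai := h.apply_mem_cIoc (R.symm ha)
    have haj := h.apply_mem_cIoc (R.trans (R.symm ha) hij)
    have hi := h.apply_mem_cIoc hij
    have hj := h.apply_mem_cIoc (R.symm hij)
    rw [swap_apply_def]
    grind [mem_cIoc]
  refine ⟨fun a => splitBlock_rel.2 ⟨hrel a, ?_⟩, fun {a b} hab => ?_⟩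
  · rw [Perm.mul_apply]
    by_cases ha : R i a
    · simpa only [ha, R.trans ha (hrel a), true_and] using hmem a ha
    · have hva : ¬ R i (v (swap i j a)) := fun h => ha (R.trans h (R.symm (hrel a)))
      simp only [ha, hva, false_and]
  · obtain ⟨hab, hiff⟩ := splitBlock_rel.1 hab
    rw [Perm.mul_apply]
    by_cases ha : R i a
    · have hib := R.trans ha hab
      simp only [ha, hib, true_and] at hiff
      have hab' := h.apply_mem_cIoc hab
      have hi := h.apply_mem_cIoc hib
      have hj := h.apply_mem_cIoc (R.trans (R.symm hij) hib)
      have hij' := h.apply_mem_cIoc hij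
      rw [swap_apply_def]
      grind [mem_cIoc]
    · rw [hout a ha]
      exact h.apply_mem_cIoc hab

lemma IsBlockRotation.le_splitBlock (hP : IsNonCrossing P) (hp : IsBlockRotation P p)
    (hq : IsBlockRotation Q q) (hPQ : P ≤ Q) (hi : p i ≠ q i) :
    P ≤ splitBlock Q i (q.symm (p i)) := by
  obtain ⟨j, hj⟩ : ∃ j, q j = p i := ⟨q.symm (p i), apply_symm_apply q _⟩
  rw [← hj, symm_apply_apply]
  have hij : Q i j := Q.trans (hPQ (hp.rel i)) (Q.symm (hj ▸ hq.rel j))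
  have hgap : ∀ a, Q i a → (a ∈ cIoc i j ↔ a ∈ cIoc i (p i) ∧ a ≠ p i) := fun a ha => by
    have hja := hq.apply_mem_cIoc (Q.trans (Q.symm hij) ha)
    have hji := hq.apply_mem_cIoc (Q.symm hij)
    rw [hj] at hja hji
    grind [mem_cIoc]
  have himp : ∀ a b, P a b → Q i a ∧ a ∈ cIoc i j → Q i b ∧ b ∈ cIoc i j := by
    rintro a b hab ⟨hia, ha⟩
    have hib := Q.trans hia (hPQ hab)
    rw [hgap a hia] at ha
    exact ⟨hib, (hgap b hib).2 (hp.mem_gap hP ha.1 ha.2 hab)⟩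
  exact fun {a b} hab => splitBlock_rel.2 ⟨hPQ hab, himp a b hab, himp b a (P.symm hab)⟩

end SplitBlock

section NoncrossingInterval

variable {n : ℕ} {P Q R : Setoid (Fin n)} {g v p q : Perm (Fin n)}

lemma IsBlockRotation.exists_of_absLE (hR : IsNonCrossing R) (hg : IsBlockRotation R g)
    (h : AbsLE v g) : ∃ Q : Setoid (Fin n), IsNonCrossing Q ∧ IsBlockRotation Q v := by
  induction hk : absLength (v⁻¹ * g) using Nat.strong_induction_on generalizing v with
  | _ k ih =>
    by_cases hvg : v = g
    · exact ⟨R, hR, hvg ▸ hg⟩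
    obtain ⟨i, j, hcycle, hle, hlt⟩ := h.exists_mul_swap hvg
    obtain ⟨Q, hQ, hv⟩ := ih _ (hk ▸ hlt) hle rfl
    refine ⟨splitBlock Q i j, hQ.splitBlock, ?_⟩
    simpa only [mul_swap_mul_self] using hv.mul_swap (hv.sameCycle_iff.1 hcycle)

lemma IsBlockRotation.absLE (hP : IsNonCrossing P) (hp : IsBlockRotation P p)
    (hq : IsBlockRotation Q q) (hPQ : P ≤ Q) : AbsLE p q := by
  induction hk : absLength q using Nat.strong_induction_on generalizing q Q with
  | _ k ih =>
    by_cases hpq : p = q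
    · exact hpq ▸ absLE_refl p
    obtain ⟨i, hi⟩ : ∃ i, p i ≠ q i := by
      by_contra! h
      exact hpq (Equiv.ext h)
    have hle := hp.le_splitBlock hP hq hPQ hi
    obtain ⟨j, hj⟩ : ∃ j, q j = p i := ⟨q.symm (p i), apply_symm_apply q _⟩
    rw [← hj, symm_apply_apply] at hle
    have hij : i ≠ j := fun h => hi (by rw [← hj, ← h])
    have hQij : Q i j := Q.trans (hPQ (hp.rel i)) (Q.symm (hj ▸ hq.rel j))
    have hcycle := hq.sameCycle_iff.2 hQij
    have hlt := (absLength_mul_swap_add_one_eq_iff hij).2 hcycle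
    exact (ih _ (by omega) (hq.mul_swap hQij) hle rfl).trans
      (absLE_mul_swap hij hcycle)

end NoncrossingInterval

section NcClosure

variable {α : Type*} [LinearOrder α] {w : Perm α}

/-- The finest noncrossing partition whose blocks are unions of cycles of `w`. -/
def ncClosure (w : Perm α) : Setoid α := sInf {Q | IsNonCrossing Q ∧ ∀ i, Q i (w i)}

lemma ncClosure_le {Q : Setoid α} (hQ : IsNonCrossing Q) (h : ∀ i, Q i (w i)) :
    ncClosure w ≤ Q :=
  sInf_le ⟨hQ, h⟩

lemma ncClosure_apply (w : Perm α) (i : α) : ncClosure w i (w i) := fun _ hQ => hQ.2 i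

lemma isNonCrossing_ncClosure (w : Perm α) : IsNonCrossing (ncClosure w) :=
  fun a b c d hab hbc hcd hac hbd Q hQ => hQ.1 a b c d hab hbc hcd (hac Q hQ) (hbd Q hQ)

lemma ncClosure_inv (w : Perm α) : ncClosure w⁻¹ = ncClosure w := by
  have hle : ∀ w : Perm α, ncClosure w⁻¹ ≤ ncClosure w := fun w =>
    ncClosure_le (isNonCrossing_ncClosure w) fun i => by
      simpa using (ncClosure w).symm (ncClosure_apply w (w⁻¹ i))
  exact le_antisymm (hle w) (by simpa using hle w⁻¹)

end NcClosure

section Projection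

variable {n : ℕ} {c w u v : Perm (Fin n)}

lemma IsNCJoin.unique (hu : IsNCJoin c w u) (hv : IsNCJoin c w v) : u = v :=
  (hu.2 _ hv.1).antisymm (hv.2 _ hu.1)

lemma IsNCJoin.ncProj_eq (h : IsNCJoin c w v) : ncProj c w = v := by
  have hex : ∃ u, IsNCJoin c w u := ⟨v, h⟩
  rw [ncProj, dif_pos hex]
  exact hex.choose_spec.unique h

lemma mem_cIoc_fin {a b x : Fin n} : x ∈ cIoc a b ↔
    if (a : ℕ) < b then (a : ℕ) < x ∧ (x : ℕ) ≤ b else (b : ℕ) < x → (a : ℕ) < x := by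
  simp only [mem_cIoc, Fin.lt_def, Fin.le_def]

lemma finRotate_apply_val {m : ℕ} (a : Fin (m + 1)) :
    (finRotate (m + 1) a : ℕ) = if (a : ℕ) = m then 0 else (a : ℕ) + 1 := by
  split_ifs with h
  · simp [show a = Fin.last m from Fin.ext h]
  · exact coe_finRotate_of_ne_last fun h' => h (congrArg Fin.val h')

lemma isBlockRotation_finRotate (m : ℕ) :
    IsBlockRotation (⊤ : Setoid (Fin (m + 1))) (finRotate (m + 1)) where
  rel _ := trivial
  apply_mem_cIoc {a b} _ := by
    rw [mem_cIoc_fin, finRotate_apply_val]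
    split_ifs <;> omega

lemma finRotate_mem_cIoc_iff {m : ℕ} (a b x : Fin (m + 1)) :
    finRotate (m + 1) x ∈ cIoc (finRotate (m + 1) a) (finRotate (m + 1) b) ↔ x ∈ cIoc a b := by
  simp only [mem_cIoc_fin, finRotate_apply_val]
  split_ifs <;> omega

lemma finRotate_pow_mem_cIoc_iff {m : ℕ} (r : ℕ) (a b x : Fin (m + 1)) :
    (finRotate (m + 1) ^ r) x ∈ cIoc ((finRotate (m + 1) ^ r) a) ((finRotate (m + 1) ^ r) b) ↔
      x ∈ cIoc a b := by
  induction r with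
  | zero => rfl
  | succ r ih => simp only [pow_succ', Perm.mul_apply, finRotate_mem_cIoc_iff, ih]

lemma isNCJoin_finRotate {m : ℕ} (w : Perm (Fin (m + 1))) :
    IsNCJoin (finRotate (m + 1)) w (blockRotation (ncClosure w)) := by
  have htop : IsNonCrossing (⊤ : Setoid (Fin (m + 1))) := fun _ _ _ _ _ _ _ _ _ => trivial
  have hrot := isBlockRotation_blockRotation (ncClosure w)
  have hnc := isNonCrossing_ncClosure w
  refine ⟨⟨⟨absLE_one _, hrot.absLE hnc (isBlockRotation_finRotate m) le_top⟩, ?_⟩, ?_⟩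
  · rintro t ⟨i, j, hij, rfl⟩ ht
    rw [absLE_swap_iff hij] at ht ⊢
    exact hrot.sameCycle_iff.2 (Quotient.exact (apply_eq_of_sameCycle
      (fun a => Quotient.sound ((ncClosure w).symm (ncClosure_apply w a))) ht))
  · rintro v ⟨⟨-, hv⟩, hbound⟩
    obtain ⟨Q, hQ, hQv⟩ := (isBlockRotation_finRotate m).exists_of_absLE htop hv
    refine hrot.absLE hnc hQv (ncClosure_le hQ fun i => ?_)
    rcases eq_or_ne i (w i) with hi | hi
    · rw [← hi]
    · rw [← hQv.sameCycle_iff, ← absLE_swap_iff hi]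
      exact hbound _ ⟨i, w i, hi, rfl⟩ ((absLE_swap_iff hi).2 ⟨1, rfl⟩)

lemma ncProj_finRotate {m : ℕ} (w : Perm (Fin (m + 1))) :
    ncProj (finRotate (m + 1)) w = blockRotation (ncClosure w) :=
  (isNCJoin_finRotate w).ncProj_eq

end Projection

section Conjugation

variable {n : ℕ} {c w v : Perm (Fin n)}

lemma IsNCUpperBound.conj (g : Perm (Fin n)) (h : IsNCUpperBound c w v) :
    IsNCUpperBound (g * c * g⁻¹) (g * w * g⁻¹) (g * v * g⁻¹) := by
  refine ⟨⟨absLE_one _, (absLE_conj_iff g).2 h.1.2⟩, ?_⟩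
  rintro t ⟨i, j, hij, rfl⟩ ht
  obtain ⟨i, rfl⟩ := g.surjective i
  obtain ⟨j, rfl⟩ := g.surjective j
  rw [swap_apply_apply, absLE_conj_iff] at ht ⊢
  exact h.2 _ ⟨i, j, ne_of_apply_ne g hij, rfl⟩ ht

lemma IsNCJoin.conj (g : Perm (Fin n)) (h : IsNCJoin c w v) :
    IsNCJoin (g * c * g⁻¹) (g * w * g⁻¹) (g * v * g⁻¹) := by
  refine ⟨h.1.conj g, fun u hu => ?_⟩
  have hinv : ∀ x : Perm (Fin n), g⁻¹ * (g * x * g⁻¹) * g⁻¹⁻¹ = x := fun x => by group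
  have hu' := hu.conj g⁻¹
  rw [hinv c, hinv w] at hu'
  have hle := (absLE_conj_iff g).2 (h.2 _ hu')
  rwa [show g * (g⁻¹ * u * g⁻¹⁻¹) * g⁻¹ = u by group] at hle

lemma popT_conj {m : ℕ} (g w : Perm (Fin (m + 1))) :
    popT (g * finRotate (m + 1) * g⁻¹) (g * w * g⁻¹) = g * popT (finRotate (m + 1)) w * g⁻¹ := by
  have h := isNCJoin_finRotate w
  rw [popT, popT, h.ncProj_eq, (h.conj g).ncProj_eq]
  group

lemma requiresExactly_conj {m : ℕ} (g w : Perm (Fin (m + 1))) (k : ℕ) :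
    RequiresExactly (g * finRotate (m + 1) * g⁻¹) (g * w * g⁻¹) k ↔
      RequiresExactly (finRotate (m + 1)) w k := by
  have hsemi : Function.Semiconj (MulAut.conj g) (popT (finRotate (m + 1)))
      (popT (g * finRotate (m + 1) * g⁻¹)) := fun w => (popT_conj g w).symm
  have hiter : ∀ k, (popT (g * finRotate (m + 1) * g⁻¹))^[k] (g * w * g⁻¹) = 1 ↔
      (popT (finRotate (m + 1)))^[k] w = 1 := fun k => by
    have := (hsemi.iterate_right k w).symm
    rw [MulAut.conj_apply] at this
    rw [this, map_eq_one_iff _ (MulAut.conj g).injective]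
  simp only [RequiresExactly, hiter]

end Conjugation

section Torse

variable {α : Type*} [LinearOrder α] {u : Perm α} {a b j : α} {k l : ℕ}

lemma mem_iff_of_ncClosure {s : Set α} (hs : s.OrdConnected) (hu : ∀ a, a ∈ s ↔ u a ∈ s)
    (hab : ncClosure u a b) : a ∈ s ↔ b ∈ s :=
  iff_of_eq (ncClosure_le (isNonCrossing_ker_mem hs) (fun a => propext (hu a)) hab)

lemma eq_of_ncClosure_of_fixed (hj : u j = j) (ha : ncClosure u j a) : a = j := by
  refine (mem_iff_of_ncClosure (Set.ordConnected_singleton (a := j)) (fun b => ?_) ha).1 rfl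
  rw [Set.mem_singleton_iff, Set.mem_singleton_iff, ← u.apply_eq_iff_eq (x := b), hj]

variable [Finite α]

/-- The inverse form of `popT`: regarding `u j` as the position of a token `j`, every token moves
to the next position of its block in the noncrossing closure. -/
noncomputable def torse (u : Perm α) : Perm α := blockRotation (ncClosure u) * u

lemma torse_apply (u : Perm α) (j : α) : torse u j = blockRotation (ncClosure u) (u j) := rfl

lemma ncClosure_torse_le (u : Perm α) : ncClosure (torse u) ≤ ncClosure u :=
  ncClosure_le (isNonCrossing_ncClosure u) fun i =>
    (ncClosure u).trans (ncClosure_apply u i) ((isBlockRotation_blockRotation _).rel _)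

lemma ncClosure_iterate_torse_antitone (u : Perm α) :
    Antitone fun k => ncClosure (torse^[k] u) :=
  antitone_nat_of_succ_le fun k => by
    rw [Function.iterate_succ_apply']
    exact ncClosure_torse_le _

lemma ncClosure_iterate_torse_apply (u : Perm α) (hkl : k ≤ l) (j : α) :
    ncClosure (torse^[k] u) j ((torse^[l] u) j) :=
  ncClosure_iterate_torse_antitone u hkl (ncClosure_apply _ _)

lemma torse_apply_of_fixed (hj : u j = j) : torse u j = j := by
  rw [torse_apply, hj]
  exact eq_of_ncClosure_of_fixed hj ((isBlockRotation_blockRotation _).rel j)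

lemma iterate_torse_apply_of_fixed (hkl : k ≤ l) (hj : (torse^[k] u) j = j) :
    (torse^[l] u) j = j := by
  induction l, hkl using Nat.le_induction with
  | base => exact hj
  | succ l _ ih =>
    rw [Function.iterate_succ_apply']
    exact torse_apply_of_fixed ih

lemma lt_torse_apply [OrderTop α] (hu : u ⊤ ≠ ⊤) : u ⊤ < torse u ⊤ := by
  have hrel := (ncClosure u).symm (ncClosure_apply u ⊤)
  exact ((mem_cIoc_of_lt hu.lt_top).1 ((isBlockRotation_blockRotation _).apply_mem_cIoc hrel)).1

end Torse

section FinRotate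

variable {m : ℕ}

lemma popT_finRotate (w : Perm (Fin (m + 1))) : popT (finRotate (m + 1)) w = (torse w⁻¹)⁻¹ := by
  rw [popT, ncProj_finRotate, torse, ncClosure_inv]
  group

lemma iterate_popT_finRotate (k : ℕ) (w : Perm (Fin (m + 1))) :
    (popT (finRotate (m + 1)))^[k] w = (torse^[k] w⁻¹)⁻¹ := by
  induction k with
  | zero => simp
  | succ k ih => rw [Function.iterate_succ_apply', Function.iterate_succ_apply', ih,
      popT_finRotate, inv_inv]

lemma iterate_torse_last_lt {u : Perm (Fin (m + 1))} {k l : ℕ} (hkl : k < l)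
    (h : (torse^[k] u) (Fin.last m) ≠ Fin.last m) :
    (torse^[k] u) (Fin.last m) < (torse^[l] u) (Fin.last m) := by
  induction l, hkl using Nat.le_induction with
  | base =>
    rw [Function.iterate_succ_apply']
    exact lt_torse_apply h
  | succ l _ ih =>
    by_cases hl : (torse^[l] u) (Fin.last m) = Fin.last m
    · rw [iterate_torse_apply_of_fixed l.le_succ hl]
      exact (Fin.le_last _).lt_of_ne h
    · rw [Function.iterate_succ_apply']
      exact ih.trans (lt_torse_apply hl)

lemma add_le_iterate_torse_last {u : Perm (Fin (m + 1))} {k : ℕ}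
    (h : (torse^[k] u) (Fin.last m) ≠ Fin.last m) :
    (u (Fin.last m) : ℕ) + k ≤ (torse^[k] u) (Fin.last m) := by
  induction k with
  | zero => rfl
  | succ k ih =>
    have hk : (torse^[k] u) (Fin.last m) ≠ Fin.last m :=
      fun hk => h (iterate_torse_apply_of_fixed k.le_succ hk)
    have hlt := Fin.lt_def.1 (iterate_torse_last_lt (Nat.lt_add_one k) hk)
    have := ih hk
    omega

lemma iterate_torse_last_eq (u : Perm (Fin (m + 1))) : (torse^[m] u) (Fin.last m) = Fin.last m := by
  by_contra h
  exact h (Fin.ext (by have := add_le_iterate_torse_last h; grind))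

lemma torse_conj {g : Perm (Fin (m + 1))} (hg : Commute g (finRotate (m + 1)))
    (u : Perm (Fin (m + 1))) : torse (g * u * g⁻¹) = g * torse u * g⁻¹ := by
  have h := popT_conj g u⁻¹
  rw [hg.eq, mul_inv_cancel_right, popT_finRotate, popT_finRotate, inv_inv,
    ← conj_inv, inv_inv] at h
  simpa [mul_assoc] using congrArg (·⁻¹) h

lemma iterate_torse_conj {g : Perm (Fin (m + 1))} (hg : Commute g (finRotate (m + 1))) (k : ℕ)
    (u : Perm (Fin (m + 1))) : torse^[k] (g * u * g⁻¹) = g * torse^[k] u * g⁻¹ :=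
  ((show Function.Semiconj (MulAut.conj g) torse torse from
    fun u => (torse_conj hg u).symm).iterate_right k u).symm

lemma exists_finRotate_pow_apply (a b : Fin (m + 1)) : ∃ r : ℕ, (finRotate (m + 1) ^ r) a = b :=
  ((isBlockRotation_finRotate m).sameCycle_iff.2 trivial).exists_nat_pow_eq

lemma exists_conj_last_ne {u : Perm (Fin (m + 1))} {k : ℕ} (h : torse^[k] u ≠ 1) :
    ∃ r : ℕ, (torse^[k] (finRotate (m + 1) ^ r * u * (finRotate (m + 1) ^ r)⁻¹)) (Fin.last m)
      ≠ Fin.last m := by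
  obtain ⟨j, hj⟩ : ∃ j, (torse^[k] u) j ≠ j := by
    by_contra! h'
    exact h (Equiv.ext h')
  obtain ⟨r, hr⟩ := exists_finRotate_pow_apply j (Fin.last m)
  refine ⟨r, fun h' => hj ?_⟩
  rw [iterate_torse_conj ((Commute.refl _).pow_left r), ← hr] at h'
  simpa using h'

lemma iterate_torse_eq_one (u : Perm (Fin (m + 1))) : torse^[m] u = 1 := by
  by_contra h
  obtain ⟨r, hr⟩ := exists_conj_last_ne h
  exact hr (iterate_torse_last_eq _)

end FinRotate

section IncreasingCycle

variable {α : Type*} [LinearOrder α]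

/-- The partition whose blocks are `S` and the singletons outside `S`. -/
def singleBlock (S : Finset α) : Setoid α where
  r a b := a = b ∨ (a ∈ S ∧ b ∈ S)
  iseqv := ⟨fun _ => .inl rfl, fun h => h.imp Eq.symm And.symm, by grind⟩

/-- The cycle that runs through the elements of `S` in increasing order. -/
noncomputable def incCycle [Finite α] (S : Finset α) : Perm α := blockRotation (singleBlock S)

variable [Fintype α] {z : Perm α} {x : α}

lemma le_of_mem_support (hz : ∀ j ≠ x, j ≤ z j) {b : α} (hb : b ∈ z.support) : b ≤ x := by
  obtain ⟨y, hy, hmax⟩ := z.support.exists_max_image id ⟨b, hb⟩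
  have hyx : y = x := by
    by_contra hne
    exact mem_support.1 hy (le_antisymm (hmax _ (apply_mem_support.2 hy)) (hz y hne))
  exact hyx ▸ hmax b hb

/-- If `z` jumped from `a` over an element `b` of its support, it would map too many elements above
`b`. -/
lemma eq_incCycle_support (hz : ∀ j ≠ x, j ≤ z j) : z = incCycle z.support := by
  refine IsBlockRotation.eq_blockRotation ⟨fun a => ?_, fun {a b} hab => ?_⟩
  · by_cases ha : a ∈ z.support
    · exact .inr ⟨ha, apply_mem_support.2 ha⟩
    · exact .inl (notMem_support.1 ha).symm
  rcases hab with rfl | ⟨ha, hb⟩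
  · simp [cIoc]
  by_contra hmem
  have hbx := le_of_mem_support hz hb
  have hza : a ≠ x → a < z a := fun h => (hz a h).lt_of_ne (mem_support.1 ha).symm
  obtain ⟨hba, hab⟩ : b < z a ∧ (a < b ∨ a = x) := by grind [mem_cIoc]
  let A := z.support.filter (b ≤ ·)
  have hbA : b ∈ A := Finset.mem_filter.2 ⟨hb, le_rfl⟩
  have haA : a ∉ A.erase x := by grind
  have hmaps : ∀ y ∈ insert a (A.erase x), z y ∈ A.erase b := fun y hy => by
    have hzy := hz y
    have hsupp := apply_mem_support (f := z) (x := y)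
    grind [mem_support]
  have hcard := Finset.card_le_card_of_injOn z hmaps z.injective.injOn
  rw [Finset.card_insert_of_notMem haA, Finset.card_erase_of_mem hbA] at hcard
  have hle := Finset.pred_card_le_card_erase (s := A) (a := x)
  exact absurd (Finset.card_pos.2 ⟨b, hbA⟩) (by omega)

end IncreasingCycle

section SkippedPosition

variable {m : ℕ} {u : Perm (Fin (m + 1))} {x : Fin (m + 1)}

/-- The sets `S` for which `c` times the increasing cycle on `S` is slow: neither singletons nor
pairs of elements that are not cyclically adjacent. -/
def IsSlowSet (S : Finset (Fin (m + 1))) : Prop :=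
  S.card ≠ 1 ∧ (S.card = 2 → ∃ a ∈ S, finRotate (m + 1) a ∈ S)

lemma exists_eq_of_strictMonoOn {q : ℕ → Fin (m + 1)} (hm : 2 ≤ m)
    (hlt : ∀ k ≤ m - 2, q k < Fin.last m) (hq : StrictMonoOn q (Set.Iic (m - 2))) :
    ∃ x, ∀ y ≠ x, y ≠ Fin.last m → ∃ k ≤ m - 2, q k = y := by
  let T : Finset (Fin (m + 1)) := insert (Fin.last m) ((Finset.Iic (m - 2)).image q)
  have hT : T.card = m := by
    rw [Finset.card_insert_of_notMem, Finset.card_image_of_injOn (by simpa using hq.injOn),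
      Nat.card_Iic]
    · omega
    · simpa using fun k hk => (hlt k hk).ne
  obtain ⟨x, hx⟩ := Finset.card_eq_one.1 (show Tᶜ.card = 1 by rw [Finset.card_compl, hT]; simp)
  have hnotMem : ∀ y, y ∉ T ↔ y = x := fun y => by
    rw [← Finset.mem_compl, hx, Finset.mem_singleton]
  refine ⟨x, fun y hyx hyl => ?_⟩
  have hy : y ∈ T := not_not.1 fun h => hyx ((hnotMem y).1 h)
  simpa [T, hyl] using hy

/-- The last token moves strictly upwards for `m - 2` steps without getting home, so on its way from
`u m` to `m` it skips at most one position `x`. -/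
lemma exists_skipped (hm : 2 ≤ m) (h : (torse^[m - 2] u) (Fin.last m) ≠ Fin.last m) :
    ∃ x, (∀ k y, (torse^[k] u) (Fin.last m) ≤ y → y ≠ x →
        ncClosure (torse^[k] u) (Fin.last m) y) ∧
      (u (Fin.last m) = 0 ∨ (u (Fin.last m) : ℕ) = 1 ∧ x = 0) := by
  have hne : ∀ k ≤ m - 2, (torse^[k] u) (Fin.last m) ≠ Fin.last m := fun k hk hk' =>
    h (iterate_torse_apply_of_fixed hk hk')
  obtain ⟨x, hx⟩ := exists_eq_of_strictMonoOn (q := fun k => (torse^[k] u) (Fin.last m)) hm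
    (fun k hk => (Fin.le_last _).lt_of_ne (hne k hk))
    fun k hk _ _ hlt => iterate_torse_last_lt hlt (hne k hk)
  refine ⟨x, fun k y hy hyx => ?_, ?_⟩
  · by_cases hyl : y = Fin.last m
    · exact hyl ▸ (ncClosure _).refl _
    obtain ⟨k', hk', rfl⟩ := hx y hyx hyl
    exact ncClosure_iterate_torse_apply u
      (not_lt.1 fun hlt => hy.not_gt (iterate_torse_last_lt hlt (hne k' hk'))) _
  · have hle := add_le_iterate_torse_last (hne (m - 2) le_rfl)
    have hlast : ((torse^[m - 2] u) (Fin.last m) : ℕ) < m :=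
      Fin.lt_def.1 ((Fin.le_last _).lt_of_ne (hne (m - 2) le_rfl))
    rcases Nat.le_one_iff_eq_zero_or_eq_one.1 (show (u (Fin.last m) : ℕ) ≤ 1 by omega) with h0 | h1
    · exact .inl (Fin.ext h0)
    · refine .inr ⟨h1, by_contra fun hx0 => ?_⟩
      obtain ⟨k, hk, hk0⟩ := hx 0 (Ne.symm hx0) (by
        rw [Ne, Fin.ext_iff, Fin.val_zero, Fin.val_last]
        omega)
      have := add_le_iterate_torse_last (hne k hk)
      rw [hk0, h1, Fin.val_zero] at this
      omega

/-- A token ahead of the last one would otherwise be stuck between the last token and its home, and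
the last token could not pass it. -/
lemma lt_apply_of_skipped
    (hx : ∀ k y, (torse^[k] u) (Fin.last m) ≤ y → y ≠ x → ncClosure (torse^[k] u) (Fin.last m) y)
    {j : Fin (m + 1)} (hjx : j ≠ x) (hjl : j ≠ Fin.last m) (hj : u (Fin.last m) < u j) :
    j < u j := by
  by_contra! hle
  have hstuck : ∀ k, (torse^[k] u) (Fin.last m) < (torse^[k] u) j ∧ (torse^[k] u) j ≤ j := by
    intro k
    induction k with
    | zero => exact ⟨hj, hle⟩
    | succ k ih =>
      rw [Function.iterate_succ_apply', torse_apply, torse_apply]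
      set v := torse^[k] u
      have hrot := isBlockRotation_blockRotation (ncClosure v)
      have hjv := (ncClosure v).symm (ncClosure_apply v j)
      have hlj : ncClosure v (Fin.last m) j := hx k j (ih.1.le.trans ih.2) hjx
      have hne : v j ≠ j := fun hvj =>
        hjl (eq_of_ncClosure_of_fixed hvj ((ncClosure v).symm hlj)).symm
      have hvj := (ncClosure v).trans ((ncClosure v).symm (ncClosure_apply v (Fin.last m)))
        ((ncClosure v).trans hlj ((ncClosure v).symm hjv))
      have h₁ := (mem_cIoc_of_lt ih.1).1 (hrot.apply_mem_cIoc hvj)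
      have h₂ := (mem_cIoc_of_lt (ih.2.lt_of_ne hne)).1 (hrot.apply_mem_cIoc hjv)
      exact ⟨h₁.2.trans_lt h₂.1, h₂.2⟩
  have hlt := (hstuck m).1
  rw [iterate_torse_last_eq] at hlt
  exact hlt.not_ge (Fin.le_last _)

lemma exists_forall_le_of_skipped {z : Perm (Fin (m + 1))} (hu : u = finRotate (m + 1) * z)
    (hx : ∀ k y, (torse^[k] u) (Fin.last m) ≤ y → y ≠ x → ncClosure (torse^[k] u) (Fin.last m) y)
    (hlast : u (Fin.last m) = 0 ∨ (u (Fin.last m) : ℕ) = 1 ∧ x = 0) :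
    ∃ x', ∀ j ≠ x', j ≤ z j := by
  have hz : ∀ j, (u j : ℕ) = if (z j : ℕ) = m then 0 else (z j : ℕ) + 1 := fun j => by
    rw [hu, Perm.mul_apply, finRotate_apply_val]
  have hval : ∀ j ≠ Fin.last m, (u j : ℕ) ≠ u (Fin.last m) := fun j hj hj' =>
    hj (u.injective (Fin.ext hj'))
  rcases hlast with h0 | ⟨h1, rfl⟩
  · rw [Fin.ext_iff, Fin.val_zero] at h0
    refine ⟨x, fun j hjx => ?_⟩
    have hzj := hz j
    by_cases hjl : j = Fin.last m
    · subst hjl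
      rw [Fin.le_def, Fin.val_last]
      split_ifs at hzj <;> omega
    · have hne := hval j hjl
      have hlt := lt_apply_of_skipped hx hjx hjl (by omega)
      split_ifs at hzj <;> omega
  · refine ⟨Fin.last m, fun j hjl => ?_⟩
    have hzj := hz j
    have hne := hval j hjl
    by_cases hj0 : j = 0
    · exact hj0 ▸ Fin.zero_le _
    · have hlt := lt_apply_of_skipped hx hj0 hjl
      split_ifs at hzj <;> omega

lemma exists_finRotate_mem_of_skipped {z : Perm (Fin (m + 1))}
    (hx : ∀ y ≠ x, ncClosure (finRotate (m + 1) * z) (Fin.last m) y)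
    (hcard : z.support.card = 2) : ∃ a ∈ z.support, finRotate (m + 1) a ∈ z.support := by
  obtain ⟨a, b, hab, rfl⟩ : ∃ a b, a < b ∧ z = swap a b := by
    obtain ⟨a, b, hab, rfl⟩ := card_support_eq_two.1 hcard
    rcases lt_or_gt_of_ne hab with hlt | hlt
    exacts [⟨a, b, hlt, rfl⟩, ⟨b, a, hlt, swap_comm a b⟩]
  have hinv : ∀ i, i ∈ Set.Ioc a b ↔ (finRotate (m + 1) * swap a b) i ∈ Set.Ioc a b := fun i => by
    rw [Set.mem_Ioc, Set.mem_Ioc, Perm.mul_apply, Fin.lt_def, Fin.lt_def, Fin.le_def, Fin.le_def,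
      finRotate_apply_val, swap_apply_def]
    split_ifs <;> grind
  have hside : ∀ y ≠ x, Fin.last m ∈ Set.Ioc a b ↔ y ∈ Set.Ioc a b := fun y hy =>
    mem_iff_of_ncClosure Set.ordConnected_Ioc hinv (hx y hy)
  have hadj : finRotate (m + 1) a = b ∨ finRotate (m + 1) b = a := by
    have ha1 := finRotate_apply_val a
    have hb1 := finRotate_apply_val b
    by_cases hb : b = Fin.last m
    · right
      have ha := hside a
      have h0 := hside 0
      grind
    · left
      have hcb := hside b
      have hca := hside (finRotate (m + 1) a)
      grind
  rw [support_swap hab.ne]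
  rcases hadj with h | h
  · exact ⟨a, by simp, by simp [h]⟩
  · exact ⟨b, by simp, by simp [h]⟩

lemma exists_isSlowSet_of_last_ne (hm : 2 ≤ m)
    (h : (torse^[m - 2] u) (Fin.last m) ≠ Fin.last m) :
    ∃ S, IsSlowSet S ∧ u = finRotate (m + 1) * incCycle S := by
  obtain ⟨x, hx, hlast⟩ := exists_skipped hm h
  obtain ⟨z, rfl⟩ : ∃ z, u = finRotate (m + 1) * z := ⟨_, (mul_inv_cancel_left _ _).symm⟩
  obtain ⟨x', hx'⟩ := exists_forall_le_of_skipped rfl hx hlast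
  suffices hle : ∀ y ≠ x, (finRotate (m + 1) * z) (Fin.last m) ≤ y from
    ⟨z.support, ⟨card_support_ne_one z,
      exists_finRotate_mem_of_skipped fun y hy => hx 0 y (hle y hy) hy⟩,
      congrArg _ (eq_incCycle_support hx')⟩
  intro y hy
  rcases hlast with h0 | ⟨h1, rfl⟩
  · exact h0 ▸ Fin.zero_le y
  · rw [Fin.le_def, h1, Nat.one_le_iff_ne_zero]
    exact Fin.val_ne_zero_iff.2 hy

end SkippedPosition

section AdvancingTokens

variable {m k : ℕ} {v : Perm (Fin (m + 1))} {x y : Fin (m + 1)}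

/-- Every token other than `x` and the last one is at a position beyond its home, or has already
passed the end and is behind the last token. -/
def IsAdvancing (v : Perm (Fin (m + 1))) (x : Fin (m + 1)) : Prop :=
  ∀ j ≠ x, j ≠ Fin.last m → v j < v (Fin.last m) ∨ j < v j

lemma IsAdvancing.rel_last (h : IsAdvancing v x) (hx : v x = x ∨ ncClosure v (Fin.last m) x)
    (hy : v (Fin.last m) ≤ y) (hyx : y ≠ x) : ncClosure v (Fin.last m) y := by
  set R := ncClosure v
  by_contra hRy
  obtain ⟨y, ⟨hy, hyx, hRy⟩, hmax⟩ := Set.exists_max_image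
    {y | v (Fin.last m) ≤ y ∧ y ≠ x ∧ ¬ R (Fin.last m) y} id (Set.toFinite _) ⟨y, hy, hyx, hRy⟩
  have hlast : R (Fin.last m) (v (Fin.last m)) := ncClosure_apply v _
  have hyl : y ≠ Fin.last m := fun h => hRy (h ▸ R.refl _)
  have hlt : v (Fin.last m) < y := hy.lt_of_ne fun h => hRy (h ▸ hlast)
  have hRvy : R (v y) y := R.symm (ncClosure_apply v y)
  have hle : v (Fin.last m) ≤ v y := by
    by_contra! hvy
    have hrel : R (v y) (v (Fin.last m)) :=
      isNonCrossing_ncClosure v _ _ _ _ hvy hlt (lt_top_iff_ne_top.2 hyl) hRvy (R.symm hlast)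
    exact hRy (R.trans hlast (R.trans (R.symm hrel) hRvy))
  have hvyx : v y ≠ x := fun hvy => hx.elim (fun hx => hyx (v.injective (hvy.trans hx.symm)))
    fun hx => hRy (R.trans hx (hvy ▸ hRvy))
  have hvy := hmax (v y) ⟨hle, hvyx, fun h => hRy (R.trans h hRvy)⟩
  exact (h y hyx hyl).elim hle.not_gt hvy.not_gt

lemma blockRotation_le_apply_last (hy : y < v (Fin.last m) ∨ y = Fin.last m) :
    blockRotation (ncClosure v) y ≤ v (Fin.last m) := by
  have hrot := isBlockRotation_blockRotation (ncClosure v)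
  set R := ncClosure v
  have hlast : R (v (Fin.last m)) (Fin.last m) := R.symm (ncClosure_apply v _)
  by_contra! hlt
  by_cases hRy : R y (v (Fin.last m))
  · have hmem := mem_cIoc.1 (hrot.apply_mem_cIoc hRy)
    have hle := Fin.le_last (blockRotation R y)
    grind
  · have hyq : y < v (Fin.last m) := hy.resolve_right fun h => hRy (by
      rw [h]
      exact R.symm hlast)
    have hne : blockRotation R y ≠ Fin.last m := fun h =>
      hRy (R.trans (h ▸ hrot.rel y) (R.symm hlast))
    exact hRy (isNonCrossing_ncClosure v _ _ _ _ hyq hlt (lt_top_iff_ne_top.2 hne)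
      (hrot.rel y) hlast)

lemma IsAdvancing.isAdvancing_torse (h : IsAdvancing v x)
    (hx : v x = x ∨ ncClosure v (Fin.last m) x) : IsAdvancing (torse v) x := by
  intro j hjx hjl
  by_cases hq : v (Fin.last m) = Fin.last m
  · rw [torse_apply_of_fixed hq]
    exact .inl (lt_top_iff_ne_top.2 fun hj =>
      hjl ((torse v).injective (hj.trans (torse_apply_of_fixed hq).symm)))
  have hq' : v (Fin.last m) < torse v (Fin.last m) := lt_torse_apply hq
  by_cases hvj : v j < v (Fin.last m) ∨ v j = Fin.last m
  · exact .inl ((blockRotation_le_apply_last hvj).trans_lt hq')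
  rw [not_or, not_lt] at hvj
  have hvjx : v j ≠ x ∨ ncClosure v (Fin.last m) x :=
    hx.imp_left fun hx hvj => hjx (v.injective (hvj.trans hx.symm))
  have hrel : ncClosure v (Fin.last m) (v j) := by
    by_cases hvj' : v j = x
    · exact hvj' ▸ hvjx.resolve_left (not_not.2 hvj')
    · exact h.rel_last hx hvj.1 hvj'
  have hlt := (mem_cIoc_of_lt (lt_top_iff_ne_top.2 hvj.2)).1
    ((isBlockRotation_blockRotation _).apply_mem_cIoc ((ncClosure v).symm hrel))
  exact .inr (((h j hjx hjl).resolve_left hvj.1.not_gt).trans hlt.1)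

lemma blockRotation_val_of_rel {R : Setoid (Fin (m + 1))} {y' : Fin (m + 1)} (hR : R y y')
    (hy : (y' : ℕ) = y + 1) : (blockRotation R y : ℕ) = y + 1 := by
  have hmem := (mem_cIoc_of_lt (Fin.lt_def.2 (by omega))).1
    ((isBlockRotation_blockRotation R).apply_mem_cIoc hR)
  rw [Fin.lt_def, Fin.le_def] at hmem
  omega

lemma IsAdvancing.torse_last_val (h : IsAdvancing v x)
    (hx : v x = x ∨ ncClosure v (Fin.last m) x) (hlt : (v (Fin.last m) : ℕ) + 1 < x) :
    (torse v (Fin.last m) : ℕ) = v (Fin.last m) + 1 := by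
  let y : Fin (m + 1) := ⟨v (Fin.last m) + 1, by omega⟩
  have hy : ncClosure v (Fin.last m) y :=
    h.rel_last hx (Fin.le_def.2 (Nat.le_succ _)) fun hyx => by simp [← hyx, y] at hlt
  exact blockRotation_val_of_rel ((ncClosure v).trans
    ((ncClosure v).symm (ncClosure_apply v _)) hy) rfl

lemma IsAdvancing.iterate_torse_last_val {u : Perm (Fin (m + 1))}
    (h : IsAdvancing u (Fin.last m)) (hlt : (u (Fin.last m) : ℕ) + k < m) :
    IsAdvancing (torse^[k] u) (Fin.last m) ∧
      ((torse^[k] u) (Fin.last m) : ℕ) = u (Fin.last m) + k := by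
  induction k with
  | zero => exact ⟨h, rfl⟩
  | succ k ih =>
    obtain ⟨hadv, hval⟩ := ih (by omega)
    have hrefl : (torse^[k] u) (Fin.last m) = Fin.last m ∨
        ncClosure (torse^[k] u) (Fin.last m) (Fin.last m) := .inr ((ncClosure _).refl _)
    rw [Function.iterate_succ_apply', hadv.torse_last_val hrefl (by rw [Fin.val_last]; omega),
      hval]
    exact ⟨hadv.isAdvancing_torse hrefl, rfl⟩

/-- Every token other than `x` and the last one has either moved by at least one position per step
without passing the end or is behind the last token; the token `x` is not yet at its home, and some
token `p` leaves the interval from the position of `x` to its home. -/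
structure IsOnSchedule (v : Perm (Fin (m + 1))) (x : Fin (m + 1)) : Prop where
  last_lt : v (Fin.last m) < v x
  add_lt : ∀ j ≠ x, j ≠ Fin.last m →
    v j < v (Fin.last m) ∨ (j : ℕ) + v (Fin.last m) < v j
  crossing : ∃ p, v x ≤ p ∧ p < x ∧ (v p < v x ∨ x < v p)

lemma IsOnSchedule.isAdvancing (h : IsOnSchedule v x) : IsAdvancing v x := fun j hjx hjl =>
  (h.add_lt j hjx hjl).imp_right fun hlt => Fin.lt_def.2 (by omega)

/-- Otherwise the block of `x` would end at `x` and begin at the position of the token `x`, so that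
no token could leave the interval between them. -/
lemma IsOnSchedule.rel_last (h : IsOnSchedule v x) (hx : (x : ℕ) + 1 = m) :
    ncClosure v (Fin.last m) x := by
  set R := ncClosure v
  by_contra hlx
  obtain ⟨p, hxp, hpx, hp⟩ := h.crossing
  have hqx : v (Fin.last m) < x := h.last_lt.trans (hxp.trans_lt hpx)
  have hxl : x < Fin.last m := Fin.lt_def.2 (by simp [← hx])
  have hnc := isNonCrossing_ncClosure v
  have hlast : R (v (Fin.last m)) (Fin.last m) := R.symm (ncClosure_apply v _)
  obtain ⟨b, hxb, hmin⟩ := Set.exists_min_image {b | R x b} id (Set.toFinite _) ⟨x, R.refl x⟩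
  have hbx : b ≤ x := hmin x (R.refl x)
  have hqb : v (Fin.last m) < b := by
    by_contra! hbq
    rcases hbq.eq_or_lt with rfl | hbq
    · exact hlx (R.symm (R.trans hxb hlast))
    · exact hlx (R.symm (R.trans hxb (R.trans (hnc _ _ _ _ hbq hqx hxl (R.symm hxb) hlast) hlast)))
  have hxmax : ∀ w, R x w → w ≤ x := fun w hw => by
    have hwl := Fin.val_lt_last fun h : w = Fin.last m => hlx (R.symm (h ▸ hw))
    exact Fin.le_def.2 (by omega)
  have hset : ∀ y, b ≤ y → y ≤ x → ∀ w, R y w → b ≤ w ∧ w ≤ x := fun y hby hyx w hyw =>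
    hnc.mem_Icc_of_rel hxb (fun w hw => ⟨hmin w hw, hxmax w hw⟩) ⟨hby, hyx⟩ hyw
  have hb : v x = b := by
    obtain ⟨s, rfl⟩ := v.surjective b
    have hs := hset _ le_rfl hbx s (R.symm (ncClosure_apply v s))
    by_contra hne
    exact (h.isAdvancing s (fun h => hne (h ▸ rfl)) (hs.2.trans_lt hxl).ne).elim hqb.not_gt
      hs.1.not_gt
  have hvp := hset p (hb ▸ hxp) hpx.le _ (ncClosure_apply v p)
  exact hp.elim (hb ▸ hvp.1).not_gt hvp.2.not_gt

lemma IsOnSchedule.torse_apply_eq_or (h : IsOnSchedule v x) (hx : (x : ℕ) + 1 = m) :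
    torse v x = x ∨ IsOnSchedule (torse v) x := by
  obtain ⟨p, hxp, hpx, -⟩ := h.crossing
  have hqx := h.last_lt
  have hrelx := h.rel_last hx
  have hval : ∀ j, v (Fin.last m) ≤ v j → v j ≠ Fin.last m → (torse v j : ℕ) = v j + 1 := by
    intro j hj hjl
    have hrel : ∀ y, v (Fin.last m) ≤ y → ncClosure v (Fin.last m) y := fun y hy =>
      if hyx : y = x then hyx ▸ hrelx else h.isAdvancing.rel_last (.inr hrelx) hy hyx
    have hlt := Fin.val_lt_last hjl
    let y : Fin (m + 1) := ⟨v j + 1, by omega⟩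
    exact blockRotation_val_of_rel (y' := y)
      ((ncClosure v).trans ((ncClosure v).symm (hrel _ hj))
        (hrel y (hj.trans (Fin.le_def.2 (Nat.le_succ _))))) rfl
  rw [Fin.lt_def] at hqx hpx
  rw [Fin.le_def] at hxp
  have hvx := hval x (Fin.le_def.2 hqx.le) (Fin.ne_of_val_ne (by rw [Fin.val_last]; omega))
  have hvl := hval (Fin.last m) le_rfl (Fin.ne_of_val_ne (by rw [Fin.val_last]; omega))
  have hadd : ∀ j ≠ x, j ≠ Fin.last m → torse v j < torse v (Fin.last m) ∨
      (j : ℕ) + torse v (Fin.last m) < torse v j := by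
    intro j hjx hjl
    by_cases hj : v j < v (Fin.last m) ∨ v j = Fin.last m
    · have := Fin.le_def.1 (blockRotation_le_apply_last hj)
      exact .inl (Fin.lt_def.2 (by rw [torse_apply]; omega))
    · rw [not_or, not_lt] at hj
      have := (h.add_lt j hjx hjl).resolve_left hj.1.not_gt
      exact .inr (by rw [hval j hj.1 hj.2]; omega)
  by_cases hxx : torse v x = x
  · exact .inl hxx
  refine .inr ⟨Fin.lt_def.2 (by omega), hadd, ⟨x - 1, by omega⟩, ?_⟩
  have hp' := hadd ⟨x - 1, by omega⟩ (Fin.ne_of_val_ne (by simp; omega))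
    (Fin.ne_of_val_ne (by simp; omega))
  simp only [Fin.lt_def, Fin.le_def, Fin.ext_iff] at *
  omega

lemma IsOnSchedule.iterate_torse_last_val {u : Perm (Fin (m + 1))} (h : IsOnSchedule u x)
    (hx : (x : ℕ) + 1 = m) (hk : (u (Fin.last m) : ℕ) + k < x) :
    IsAdvancing (torse^[k] u) x ∧ ((torse^[k] u) (Fin.last m) : ℕ) = u (Fin.last m) + k ∧
      ((torse^[k] u) x = x ∨ IsOnSchedule (torse^[k] u) x) := by
  induction k with
  | zero => exact ⟨h.isAdvancing, rfl, .inr h⟩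
  | succ k ih =>
    obtain ⟨hadv, hval, hsched⟩ := ih (by omega)
    have hrel := hsched.imp_right fun h => h.rel_last hx
    rw [Function.iterate_succ_apply', hadv.torse_last_val hrel (by omega), hval]
    exact ⟨hadv.isAdvancing_torse hrel, rfl,
      hsched.elim (fun h => .inl (torse_apply_of_fixed h)) fun h => h.torse_apply_eq_or hx⟩

end AdvancingTokens

section IncCycle

variable {α : Type*} [LinearOrder α] [Finite α] {S : Finset α} {a b x : α}

lemma isBlockRotation_incCycle (S : Finset α) : IsBlockRotation (singleBlock S) (incCycle S) :=
  isBlockRotation_blockRotation _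

lemma incCycle_apply_mem_cIoc (ha : a ∈ S) (hb : b ∈ S) : incCycle S a ∈ cIoc a b :=
  (isBlockRotation_incCycle S).apply_mem_cIoc (.inr ⟨ha, hb⟩)

lemma incCycle_apply_of_notMem (ha : a ∉ S) : incCycle S a = a := by
  rcases (isBlockRotation_incCycle S).rel a with h | h
  · exact h.symm
  · exact absurd h.1 ha

lemma incCycle_apply_mem (ha : a ∈ S) : incCycle S a ∈ S := by
  rcases (isBlockRotation_incCycle S).rel a with h | h
  · exact h ▸ ha
  · exact h.2

lemma le_incCycle_apply (hx : x ∈ S) (hmax : ∀ b ∈ S, b ≤ x) (hax : a ≠ x) :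
    a ≤ incCycle S a := by
  by_cases ha : a ∈ S
  · exact ((mem_cIoc_of_lt ((hmax a ha).lt_of_ne hax)).1 (incCycle_apply_mem_cIoc ha hx)).1.le
  · exact (incCycle_apply_of_notMem ha).ge

lemma incCycle_map {g : Perm α} (hg : ∀ a b x, g x ∈ cIoc (g a) (g b) ↔ x ∈ cIoc a b)
    (S : Finset α) : incCycle (S.map g.toEmbedding) = g * incCycle S * g⁻¹ := by
  refine ((isBlockRotation_incCycle S).conj hg |>.unique ?_).symm
  convert isBlockRotation_incCycle (S.map g.toEmbedding) using 1
  ext a b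
  change _ ∨ _ ↔ _ ∨ _
  simp only [Finset.mem_map_equiv, EmbeddingLike.apply_eq_iff_eq]

end IncCycle

section SlowSets

variable {m : ℕ} {S : Finset (Fin (m + 1))} {x : Fin (m + 1)}

lemma finRotate_mul_incCycle_map (S : Finset (Fin (m + 1))) (r : ℕ) :
    finRotate (m + 1) * incCycle (S.map (finRotate (m + 1) ^ r).toEmbedding) =
      finRotate (m + 1) ^ r * (finRotate (m + 1) * incCycle S) * (finRotate (m + 1) ^ r)⁻¹ := by
  rw [incCycle_map (finRotate_pow_mem_cIoc_iff r)]
  simp only [← mul_assoc, (Commute.pow_self (finRotate (m + 1)) r).eq]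

lemma iterate_torse_incCycle_map_eq_one_iff (S : Finset (Fin (m + 1))) (k r : ℕ) :
    torse^[k] (finRotate (m + 1) * incCycle (S.map (finRotate (m + 1) ^ r).toEmbedding)) = 1 ↔
      torse^[k] (finRotate (m + 1) * incCycle S) = 1 := by
  rw [finRotate_mul_incCycle_map, iterate_torse_conj (Commute.pow_self _ r), conj_eq_one_iff]

lemma finRotate_pow_apply_finRotate (r : ℕ) (a : Fin (m + 1)) :
    (finRotate (m + 1) ^ r) (finRotate (m + 1) a) =
      finRotate (m + 1) ((finRotate (m + 1) ^ r) a) :=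
  Equiv.congr_fun (Commute.pow_self (finRotate (m + 1)) r).eq a

lemma iterate_torse_ne_one_of_isAdvancing {u : Perm (Fin (m + 1))} (hm : 2 ≤ m)
    (h : IsAdvancing u (Fin.last m)) (hu : (u (Fin.last m) : ℕ) ≤ 1) : torse^[m - 2] u ≠ 1 := by
  intro h1
  have hval := (h.iterate_torse_last_val (k := m - 2) (by omega)).2
  rw [h1, Perm.one_apply, Fin.val_last] at hval
  omega

lemma iterate_torse_finRotate_ne_one (hm : 2 ≤ m) :
    torse^[m - 2] (finRotate (m + 1)) ≠ 1 := by
  refine iterate_torse_ne_one_of_isAdvancing hm (fun j _ hj => .inr ?_) ?_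
  · rw [Fin.lt_def, coe_finRotate_of_ne_last hj]
    exact Nat.lt_succ_self _
  · rw [finRotate_last]
    exact Nat.zero_le 1

lemma iterate_torse_ne_one_of_zero_last_mem (hm : 2 ≤ m) (h0 : 0 ∈ S) (hl : Fin.last m ∈ S) :
    torse^[m - 2] (finRotate (m + 1) * incCycle S) ≠ 1 := by
  have hz : incCycle S (Fin.last m) = 0 := by
    have := (mem_cIoc.1 (incCycle_apply_mem_cIoc hl h0))
    have := Fin.le_last (incCycle S (Fin.last m))
    grind
  have hu : ((finRotate (m + 1) * incCycle S) (Fin.last m) : ℕ) = 1 := by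
    rw [Perm.mul_apply, hz, finRotate_apply_val, if_neg (by rw [Fin.val_zero]; omega), Fin.val_zero]
  refine iterate_torse_ne_one_of_isAdvancing hm (fun j hj _ => ?_) hu.le
  by_cases hzj : incCycle S j = Fin.last m
  · left
    rw [Fin.lt_def, hu, Perm.mul_apply, hzj, finRotate_last]
    exact Nat.zero_lt_one
  · right
    have hle := Fin.le_def.1 (le_incCycle_apply hl (fun b _ => Fin.le_last b) hj)
    rw [Fin.lt_def, Perm.mul_apply, coe_finRotate_of_ne_last hzj]
    omega

lemma incCycle_apply_lt_and_exists (hxS : x ∈ S) (hmax : ∀ b ∈ S, b ≤ x) (hcard : 3 ≤ S.card) :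
    incCycle S x < x ∧ ∃ p, incCycle S x < p ∧ p < x ∧ incCycle S p = x := by
  obtain ⟨s, hs⟩ : ((S.erase x).erase (incCycle S x)).Nonempty := by
    rw [← Finset.card_pos]
    have := Finset.pred_card_le_card_erase (s := S) (a := x)
    have := Finset.pred_card_le_card_erase (s := S.erase x) (a := incCycle S x)
    omega
  rw [Finset.mem_erase, Finset.mem_erase] at hs
  obtain ⟨hszx, hsx, hsS⟩ := hs
  obtain ⟨p, hp⟩ := (incCycle S).surjective x
  have hpS : p ∈ S := by_contra fun hpS => hpS (by rwa [← incCycle_apply_of_notMem hpS, hp])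
  have hzx := hmax _ (incCycle_apply_mem hxS)
  have hxs := mem_cIoc.1 (incCycle_apply_mem_cIoc hxS hsS)
  have hxp := mem_cIoc.1 (incCycle_apply_mem_cIoc hxS hpS)
  have hps := mem_cIoc.1 (incCycle_apply_mem_cIoc hpS hsS)
  have hsmax := hmax s hsS
  have hpmax := hmax p hpS
  rw [hp] at hps
  have hlt : incCycle S x < x := by grind
  exact ⟨hlt, p, by grind, by grind, hp⟩

lemma isOnSchedule_finRotate_mul_incCycle (hx : (x : ℕ) + 1 = m) (hxS : x ∈ S)
    (hl : Fin.last m ∉ S) (hcard : 3 ≤ S.card) :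
    IsOnSchedule (finRotate (m + 1) * incCycle S) x := by
  have hzl : incCycle S (Fin.last m) = Fin.last m := incCycle_apply_of_notMem hl
  have hu : ∀ j ≠ Fin.last m, ((finRotate (m + 1) * incCycle S) j : ℕ) = incCycle S j + 1 :=
    fun j hj => coe_finRotate_of_ne_last fun h => hj ((incCycle S).injective (h.trans hzl.symm))
  have hul : ((finRotate (m + 1) * incCycle S) (Fin.last m) : ℕ) = 0 := by
    rw [Perm.mul_apply, hzl, finRotate_last, Fin.val_zero]
  have hmax : ∀ b ∈ S, b ≤ x := fun b hb => by
    have := Fin.val_lt_last fun h : b = Fin.last m => hl (h ▸ hb)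
    exact Fin.le_def.2 (by omega)
  have hux := hu x fun h => hl (h ▸ hxS)
  refine ⟨Fin.lt_def.2 (by omega), fun j hjx hjl => .inr ?_, ?_⟩
  · have := Fin.le_def.1 (le_incCycle_apply hxS hmax hjx)
    rw [hu j hjl]
    omega
  · obtain ⟨-, p, hxp, hpx, hp⟩ := incCycle_apply_lt_and_exists hxS hmax hcard
    have hup := hu p (hpx.trans_le (Fin.le_last x)).ne
    rw [hp] at hup
    rw [Fin.lt_def] at hxp
    exact ⟨p, Fin.le_def.2 (by omega), hpx, .inr (Fin.lt_def.2 (by omega))⟩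

lemma iterate_torse_ne_one_of_last_notMem (hx : (x : ℕ) + 1 = m) (hxS : x ∈ S)
    (hl : Fin.last m ∉ S) (hcard : 3 ≤ S.card) :
    torse^[m - 2] (finRotate (m + 1) * incCycle S) ≠ 1 := by
  intro h1
  have hul : (finRotate (m + 1) * incCycle S) (Fin.last m) = 0 := by
    rw [Perm.mul_apply, incCycle_apply_of_notMem hl, finRotate_last]
  have hm : S.card ≤ m := by
    simpa using Finset.card_lt_univ_of_notMem hl
  have hval := ((isOnSchedule_finRotate_mul_incCycle hx hxS hl hcard).iterate_torse_last_val hx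
    (k := m - 2) (by rw [hul, Fin.val_zero]; omega)).2.1
  rw [h1, Perm.one_apply, hul, Fin.val_last, Fin.val_zero] at hval
  omega

lemma iterate_torse_ne_one_of_finRotate_mem (hm : 2 ≤ m) (hx : x ∈ S)
    (hcx : finRotate (m + 1) x ∈ S) : torse^[m - 2] (finRotate (m + 1) * incCycle S) ≠ 1 := by
  obtain ⟨r, hr⟩ := exists_finRotate_pow_apply x (Fin.last m)
  rw [Ne, ← iterate_torse_incCycle_map_eq_one_iff S _ r]
  refine iterate_torse_ne_one_of_zero_last_mem hm ?_ (hr ▸ Finset.mem_map_of_mem _ hx)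
  rw [← finRotate_last, ← hr, ← finRotate_pow_apply_finRotate]
  exact Finset.mem_map_of_mem _ hcx

lemma iterate_torse_ne_one_of_finRotate_notMem (hx : x ∈ S) (hcx : finRotate (m + 1) x ∉ S)
    (hcard : 3 ≤ S.card) : torse^[m - 2] (finRotate (m + 1) * incCycle S) ≠ 1 := by
  have hm : S.card ≤ m := by simpa using Finset.card_lt_univ_of_notMem hcx
  obtain ⟨r, hr⟩ := exists_finRotate_pow_apply x ⟨m - 1, by omega⟩
  have hval : ((finRotate (m + 1) ^ r) x : ℕ) = m - 1 := by rw [hr]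
  have hlast : (finRotate (m + 1) ^ r) (finRotate (m + 1) x) = Fin.last m := by
    rw [Fin.ext_iff, finRotate_pow_apply_finRotate, finRotate_apply_val, hval, Fin.val_last,
      if_neg (by omega)]
    omega
  rw [Ne, ← iterate_torse_incCycle_map_eq_one_iff S _ r]
  refine iterate_torse_ne_one_of_last_notMem (x := (finRotate (m + 1) ^ r) x) (by omega)
    (Finset.mem_map_of_mem _ hx) (fun hl => hcx ?_) (by rwa [Finset.card_map])
  rw [← hlast] at hl
  exact (Finset.mem_map' _).1 hl

lemma iterate_torse_ne_one_of_isSlowSet (hm : 2 ≤ m) (hS : IsSlowSet S) :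
    torse^[m - 2] (finRotate (m + 1) * incCycle S) ≠ 1 := by
  rcases S.eq_empty_or_nonempty with rfl | ⟨x, hx⟩
  · have hone : incCycle (∅ : Finset (Fin (m + 1))) = 1 :=
      Equiv.ext fun a => incCycle_apply_of_notMem (Finset.notMem_empty a)
    rw [hone, mul_one]
    exact iterate_torse_finRotate_ne_one hm
  by_cases hadj : ∃ a ∈ S, finRotate (m + 1) a ∈ S
  · obtain ⟨a, ha, hca⟩ := hadj
    exact iterate_torse_ne_one_of_finRotate_mem hm ha hca
  · have hpos := Finset.card_pos.2 ⟨x, hx⟩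
    have hne := mt hS.2 hadj
    exact iterate_torse_ne_one_of_finRotate_notMem hx (fun hcx => hadj ⟨x, hx, hcx⟩)
      (by have := hS.1; omega)

lemma isSlowSet_map_finRotate_pow (r : ℕ) :
    IsSlowSet (S.map (finRotate (m + 1) ^ r).toEmbedding) ↔ IsSlowSet S := by
  have hmem : ∀ a, (finRotate (m + 1) ^ r) a ∈ S.map (finRotate (m + 1) ^ r).toEmbedding ↔ a ∈ S :=
    fun a => Finset.mem_map' _
  rw [IsSlowSet, IsSlowSet, Finset.card_map, ← (finRotate (m + 1) ^ r).exists_congr_right]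
  simp only [hmem, ← finRotate_pow_apply_finRotate]

lemma iterate_torse_ne_one_iff (hm : 2 ≤ m) {u : Perm (Fin (m + 1))} :
    torse^[m - 2] u ≠ 1 ↔ ∃ S, IsSlowSet S ∧ finRotate (m + 1) * incCycle S = u := by
  refine ⟨fun h => ?_, fun ⟨S, hS, hu⟩ => hu ▸ iterate_torse_ne_one_of_isSlowSet hm hS⟩
  obtain ⟨r, hr⟩ := exists_conj_last_ne h
  obtain ⟨S', hS, hu⟩ := exists_isSlowSet_of_last_ne hm hr
  obtain ⟨S, rfl⟩ := ((finRotate (m + 1) ^ r).finsetCongr).surjective S'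
  rw [Equiv.finsetCongr_apply] at hS hu
  refine ⟨S, (isSlowSet_map_finRotate_pow r).1 hS, ?_⟩
  rw [finRotate_mul_incCycle_map] at hu
  exact mul_left_cancel (mul_right_cancel hu.symm)

end SlowSets

section Counting

variable {m : ℕ} {S : Finset (Fin (m + 1))}

lemma support_incCycle (hS : S.card ≠ 1) : (incCycle S).support = S := by
  ext a
  rw [mem_support]
  refine ⟨fun h => by_contra fun ha => h (incCycle_apply_of_notMem ha), fun ha h => hS ?_⟩
  refine Finset.card_eq_one.2 ⟨a, Finset.eq_singleton_iff_unique_mem.2 ⟨ha, fun b hb => ?_⟩⟩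
  have hab := (isBlockRotation_incCycle S).sameCycle_iff.2 (.inr ⟨ha, hb⟩)
  exact (hab.eq_of_left h).symm

lemma ncard_iterate_torse_ne_one (hm : 2 ≤ m) :
    {u : Perm (Fin (m + 1)) | torse^[m - 2] u ≠ 1}.ncard =
      {S : Finset (Fin (m + 1)) | IsSlowSet S}.ncard := by
  have himage : {u : Perm (Fin (m + 1)) | torse^[m - 2] u ≠ 1} =
      (fun S => finRotate (m + 1) * incCycle S) '' {S | IsSlowSet S} :=
    Set.ext fun u => iterate_torse_ne_one_iff hm
  rw [himage]
  refine Set.InjOn.ncard_image fun S hS S' hS' h => ?_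
  rw [← support_incCycle hS.1, ← support_incCycle hS'.1, mul_left_cancel h]

lemma finRotate_apply_ne_self (hm : 1 ≤ m) (a : Fin (m + 1)) : finRotate (m + 1) a ≠ a := by
  rw [Ne, Fin.ext_iff, finRotate_apply_val]
  split_ifs <;> omega

lemma finRotate_apply_finRotate_apply_ne_self (hm : 2 ≤ m) (a : Fin (m + 1)) :
    finRotate (m + 1) (finRotate (m + 1) a) ≠ a := by
  rw [Ne, Fin.ext_iff, finRotate_apply_val, finRotate_apply_val]
  split_ifs <;> omega

/-- The pairs of cyclically adjacent elements. -/
def adjacentPairs (m : ℕ) : Finset (Finset (Fin (m + 1))) :=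
  Finset.univ.image fun a => {a, finRotate (m + 1) a}

lemma mem_adjacentPairs (hm : 1 ≤ m) :
    S ∈ adjacentPairs m ↔ S.card = 2 ∧ ∃ a ∈ S, finRotate (m + 1) a ∈ S := by
  have hcard : ∀ a, ({a, finRotate (m + 1) a} : Finset (Fin (m + 1))).card = 2 := fun a =>
    Finset.card_pair (finRotate_apply_ne_self hm a).symm
  rw [adjacentPairs, Finset.mem_image]
  constructor
  · rintro ⟨a, -, rfl⟩
    exact ⟨hcard a, a, by simp, by simp⟩
  · rintro ⟨hS, a, ha, hca⟩
    refine ⟨a, Finset.mem_univ a, Finset.eq_of_subset_of_card_le ?_ (by rw [hS, hcard])⟩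
    exact Finset.insert_subset ha (Finset.singleton_subset_iff.2 hca)

lemma card_adjacentPairs (hm : 2 ≤ m) : (adjacentPairs m).card = m + 1 := by
  rw [adjacentPairs, Finset.card_image_of_injective, Finset.card_univ, Fintype.card_fin]
  intro a b (hab : {a, finRotate (m + 1) a} = ({b, finRotate (m + 1) b} : Finset _))
  have ha : a ∈ ({b, finRotate (m + 1) b} : Finset _) := hab ▸ Finset.mem_insert_self _ _
  have hb : b ∈ ({a, finRotate (m + 1) a} : Finset _) := hab ▸ Finset.mem_insert_self _ _
  have hne := finRotate_apply_finRotate_apply_ne_self hm a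
  grind

lemma ncard_isSlowSet (hm : 2 ≤ m) :
    ({S : Finset (Fin (m + 1)) | IsSlowSet S}.ncard : ℤ) =
      2 ^ (m + 1) - ((m + 1).choose 2 : ℤ) := by
  let sets (k : ℕ) : Finset (Finset (Fin (m + 1))) := Finset.univ.powersetCard k
  have hcard : ∀ k, (sets k).card = (m + 1).choose k := fun k => by
    rw [Finset.card_powersetCard, Finset.card_univ, Fintype.card_fin]
  have hsub : adjacentPairs m ⊆ sets 2 := fun S hS =>
    Finset.mem_powersetCard_univ.2 ((mem_adjacentPairs (by omega)).1 hS).1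
  have hdisj : Disjoint (sets 1) (sets 2 \ adjacentPairs m) :=
    (Finset.pairwise_disjoint_powersetCard _ (by decide)).mono_right Finset.sdiff_subset
  have hslow : {S : Finset (Fin (m + 1)) | IsSlowSet S} =
      ↑(sets 1 ∪ (sets 2 \ adjacentPairs m))ᶜ := by
    ext S
    have h2 := mem_adjacentPairs (S := S) (show 1 ≤ m by omega)
    simp only [IsSlowSet, sets, Set.mem_ofPred_eq, Finset.mem_coe, Finset.mem_compl,
      Finset.mem_union, Finset.mem_sdiff, Finset.mem_powersetCard_univ, h2]
    grind
  have hadd := Finset.card_compl_add_card (sets 1 ∪ (sets 2 \ adjacentPairs m))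
  have hsdiff := Finset.card_sdiff_add_card_eq_card hsub
  rw [Finset.card_union_of_disjoint hdisj, hcard, Nat.choose_one_right, Fintype.card_finset,
    Fintype.card_fin] at hadd
  rw [hcard, card_adjacentPairs hm] at hsdiff
  rw [hslow, Set.ncard_coe_finset]
  zify at hadd hsdiff
  linarith

lemma requiresExactly_or_iff (hm : 2 ≤ m) (g w : Perm (Fin (m + 1))) :
    (RequiresExactly (g * finRotate (m + 1) * g⁻¹) (g * w⁻¹ * g⁻¹) (m - 1) ∨
      RequiresExactly (g * finRotate (m + 1) * g⁻¹) (g * w⁻¹ * g⁻¹) m) ↔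
    torse^[m - 2] w ≠ 1 := by
  have hiter : ∀ k, (popT (finRotate (m + 1)))^[k] w⁻¹ = 1 ↔ torse^[k] w = 1 := fun k => by
    rw [iterate_popT_finRotate, inv_inv, inv_eq_one]
  have hmono : ∀ {k l}, k ≤ l → torse^[k] w = 1 → torse^[l] w = 1 := fun hkl h =>
    Equiv.ext fun j => iterate_torse_apply_of_fixed hkl (by rw [h, Perm.one_apply])
  rw [requiresExactly_conj, requiresExactly_conj]
  simp only [RequiresExactly, hiter]
  refine ⟨?_, fun h => ?_⟩
  · rintro (h | h) h1 <;> exact absurd (h.2 h1) (by omega)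
  have hlt : ∀ k, torse^[k] w = 1 → m - 1 ≤ k := fun k hk => by
    by_contra! hlt
    exact h (hmono (by omega) hk)
  by_cases h1 : torse^[m - 1] w = 1
  · exact .inl ⟨h1, hlt⟩
  · refine .inr ⟨iterate_torse_eq_one w, fun k hk => ?_⟩
    by_contra! hkm
    exact h1 (hmono (by omega) hk)

end Counting

end PopTsack

/-- Here `c` is any `n`-cycle. These are the Coxeter elements of `𝔖_n` (for all choices of simple
reflections); `c = (1 2 ⋯ n)`, that is `finRotate n`, is one of them. -/
theorem corollary2p2 (n : ℕ) (hn : 3 ≤ n) (c : Equiv.Perm (Fin n))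
    (hc : c.IsCycle) (hsupp : c.support = Finset.univ) :
    (Set.ncard {w : Equiv.Perm (Fin n) |
        PopTsack.RequiresExactly c w (n - 2) ∨ PopTsack.RequiresExactly c w (n - 1)} : ℤ)
      = 2 ^ n - (n.choose 2 : ℤ) := by
  obtain ⟨m, rfl⟩ : ∃ m, n = m + 1 := ⟨n - 1, by omega⟩
  have hm : 2 ≤ m := by omega
  obtain ⟨g, rfl⟩ : ∃ g, g * finRotate (m + 1) * g⁻¹ = c :=
    isConj_iff.1 ((isCycle_finRotate_of_le (by omega)).isConj hc
      (by rw [hsupp, support_finRotate_of_le (by omega)]))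
  let e : Equiv.Perm (Fin (m + 1)) ≃ Equiv.Perm (Fin (m + 1)) :=
    (Equiv.inv _).trans (MulAut.conj g).toEquiv
  have hset : {u | PopTsack.torse^[m - 2] u ≠ 1} = e ⁻¹' {w |
      PopTsack.RequiresExactly (g * finRotate (m + 1) * g⁻¹) w (m + 1 - 2) ∨
        PopTsack.RequiresExactly (g * finRotate (m + 1) * g⁻¹) w (m + 1 - 1)} :=
    Set.ext fun u => (PopTsack.requiresExactly_or_iff hm g u).symm
  rw [← PopTsack.ncard_isSlowSet hm, ← PopTsack.ncard_iterate_torse_ne_one hm, hset,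
    ← e.image_symm_eq_preimage, Set.ncard_image_of_injective _ e.symm.injective]
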